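/- For $L\ge1$ consider the totally asymmetric simple exclusion process on the sites $1,\dots,L$, the finite-volume version of the semi-infinite TASEP whose boundary site $0$ is always occupied: particles enter the empty site $1$ at rate $r\ge0$, jump from site $i$ to an empty site $i+1$ at rate $1$ $(1\le i<L)$, and leave site $L$ at rate $1$. Put $$Q_L(r)=\sum_{j=0}^{L}\frac{L+1-j}{L+1}\binom{L+j}{L}r^j\quad(L\ge0),\qquad j_L(r)=\frac{r\,Q_{L-1}(r)}{Q_L(r)}\quad(L\ge1).$$ Let $\Gamma=\{r\in\mathbb C:\ |r(1-r)|=1/4,\ \operatorname{Re} r\le 1/2\}$. Then: (a) For every $L\ge1$ and every real $r\ge0$, $Q_L(r)\neq0$, the process has a unique stationary distribution, and in it the mean current across each of the $L+1$ bonds (including entry and exit) equals $j_L(r)$. (b) $\Gamma$ is a simple closed curve. For every complex $r$ in its interior (the points lying in a bounded component of $\mathbb C\setminus\Gamma$), $Q_L(r)\ne0$ for all large $L$ and $\lim_{L\to\infty}j_L(r)=r(1-r)$. For every complex $r$ in its exterior (the points lying in an unbounded component of $\mathbb C\setminus\Gamma$), $Q_L(r)\neq0$ for all large $L$ and $\lim_{L\to\infty}j_L(r)=1/4$.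 (c) For every real $r\ge0$ the limit $j(r)=\lim_{L\to\infty}j_L(r)$ exists and is real, and $r_c=1/2$ is the unique critical value, that is, the unique $c\ge0$ such that $j(r)<1/4$ for $0\le r<c$ and $j(r)=1/4$ for $r>c$. (d) For every $L\ge1$, $j_L$ is analytic at $0$ and its Taylor coefficients at $0$ of orders $0,\dots,L+1$ are those of $r(1-r)$; that is, $j_L(r)=r(1-r)+O(r^{L+2})$ as $r\to0$. -/

import Mathlib

open Filter Topology

namespace SemiInfTASEP

/-! ### The finite-volume model: TASEP on sites `1, …, L` -/

/-- Configurations on the sites `1, …, L`; the index `i : Fin L` stands for the site `i + 1`,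
and `true` means occupied. -/
abbrev Config (L : ℕ) : Type := Fin L → Bool

/-- Occupation of the site `k`, including the boundary: the site `0` is always occupied, and the
sites to the right of `L` are always empty (so that particles at `L` are free to exit). -/
def occ {L : ℕ} (η : Config L) : ℕ → Bool
  | 0 => true
  | k + 1 => if h : k < L then η ⟨k, h⟩ else false

/-- A particle may jump across the bond `b`, from the site `b` to the site `b + 1`. -/
def CanJump {L : ℕ} (η : Config L) (b : ℕ) : Prop :=
  occ η b = true ∧ occ η (b + 1) = false

instance {L : ℕ} (η : Config L) (b : ℕ) : Decidable (CanJump η b) := by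
  unfold CanJump; infer_instance

/-- The configuration after a jump across the bond `b`: the site `b` is emptied and the site
`b + 1` is filled (where these are among the sites `1, …, L`). -/
def jump {L : ℕ} (η : Config L) (b : ℕ) : Config L := fun i =>
  if (i : ℕ) + 1 = b then false else if (i : ℕ) = b then true else η i

/-- Jump rate across the bond `b`: particles enter the site `1` from the site `0` at rate `r`;
all other jumps, and the exit from the site `L`, have rate `1`. -/
def bondRate (r : ℝ) (b : ℕ) : ℝ := if b = 0 then r else 1

/-- Total rate of the jumps that lead from `η` to `ζ`, over the bonds `0, …, L`. -/
def transRate {L : ℕ} (r : ℝ) (η ζ : Config L) : ℝ :=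
  ∑ b ∈ Finset.range (L + 1), if CanJump η b ∧ jump η b = ζ then bondRate r b else 0

/-- The generator, acting on column vectors of probabilities: the entry `(ζ, η)` is the rate from
`η` to `ζ` off the diagonal, and the columns sum to zero. -/
def generator (L : ℕ) (r : ℝ) : Matrix (Config L) (Config L) ℝ := fun ζ η =>
  if ζ = η then -∑ ξ ∈ Finset.univ.erase η, transRate r η ξ else transRate r η ζ

/-- `p` is a stationary probability distribution of the model on `L` sites with entry rate `r`. -/
def IsStationary (L : ℕ) (r : ℝ) (p : Config L → ℝ) : Prop :=
  (∀ η, 0 ≤ p η) ∧ ∑ η, p η = 1 ∧ (generator L r).mulVec p = 0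

/-- The mean current across the bond `b` in the distribution `p`. -/
def bondCurrent {L : ℕ} (r : ℝ) (p : Config L → ℝ) (b : ℕ) : ℝ :=
  ∑ η, if CanJump η b then bondRate r b * p η else 0

/-! ### The current as a rational function of a complex entry rate -/

/-- `Q_L(r) = ∑_{j=0}^L (L+1-j)/(L+1) * binom(L+j, L) * r^j`. -/
noncomputable def Q (L : ℕ) (r : ℂ) : ℂ :=
  ∑ j ∈ Finset.range (L + 1),
    ((L : ℂ) + 1 - (j : ℂ)) / ((L : ℂ) + 1) * ((L + j).choose L : ℂ) * r ^ j

/-- `j_L(r) = r Q_{L-1}(r) / Q_L(r)`, for `L ≥ 1` and where `Q_L(r) ≠ 0`. -/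
noncomputable def current (L : ℕ) (r : ℂ) : ℂ := r * Q (L - 1) r / Q L r

/-- `c` is the critical value for the infinite-volume current `j(r)`, `r ≥ 0`:
`j(r) < 1/4` for `r < c` and `j(r) = 1/4` for `r > c`. -/
def IsCriticalValue (j : ℝ → ℝ) (c : ℝ) : Prop :=
  0 ≤ c ∧ (∀ r, 0 ≤ r → r < c → j r < 1 / 4) ∧ (∀ r, c < r → j r = 1 / 4)

/-! ### The curve and its two sides -/

/-- The curve `|r (1 - r)| = 1/4`, `Re r ≤ 1/2`. -/
def Γ : Set ℂ := {r | ‖r * (1 - r)‖ = 1 / 4 ∧ r.re ≤ 1 / 2}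

/-- A simple closed curve: a continuous injective image of the circle. -/
def IsSimpleClosedCurve (C : Set ℂ) : Prop :=
  ∃ γ : Circle → ℂ, Continuous γ ∧ Function.Injective γ ∧ Set.range γ = C

/-- The points enclosed by `C`: those in the bounded components of the complement. -/
def inside (C : Set ℂ) : Set ℂ :=
  {z | z ∈ Cᶜ ∧ Bornology.IsBounded (connectedComponentIn Cᶜ z)}

/-- The points exterior to `C`: those in the unbounded components of the complement. -/
def outside (C : Set ℂ) : Set ℂ :=
  {z | z ∈ Cᶜ ∧ ¬ Bornology.IsBounded (connectedComponentIn Cᶜ z)}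

end SemiInfTASEP

namespace SemiInfTASEP

/-! Stationary weights come from a matrix product. An empty site acts on real sequences as the shift
`emptyOp` (E), an occupied one as `fullOp` (D), with D E = r(D + E) in the order in which functions
compose reversed: `emptyOp (fullOp φ) = r • (fullOp φ + emptyOp φ)`. The constant sequence 1 is
fixed by the shift (entry), and evaluation at 0 turns `fullOp` into multiplication by r (exit).
These relations make the master equation telescope (`flux_eq`) and give every bond the same
unnormalized current r Z_{L-1}. The normalization Z_L is the value at 0 of (D + E)^L applied to 1; a
ballot-number count identifies it with Q_L(r) (`totalSeq_apply_zero`). Uniqueness is a maximum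
principle for the transposed generator.

Analytically all rests on (1 - r) Q_{L+1} = Q_L - C_{L+1} r^{L+2}, with C_k the Catalan numbers
(`one_sub_mul_Q_succ`). Dividing by Q_{L+1} gives the Taylor statement. Iterating it, with x = r(1 -
r), T_L := (1 - r)^{L+1} Q_L = 1 - r ∑_{k≤L} C_k x^k, and j_{L+1} = x T_L / T_{L+1} for r ≠ 1. The
Catalan series has radius 1/4 and its sum is 1/(1 - r) or 1/r. On the left lobe it is 1/(1 - r), T_L
has a nonzero limit, and j → x. On the right lobe it is 1/r, so T_L is r times the tail of the
series, whose consecutive ratio tends to 1/(4x). For |x| > 1/4 the last terms of the divergent sum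
dominate and the ratio is again 1/(4x). Either way j → 1/4. The points r = 1/2 and r = 1 are
computed explicitly. -/

/-- The ballot numbers `binom(L+j, L) - binom(L+j, L+1)`. -/
def ballot (L j : ℕ) : ℤ := (L + j).choose L - (L + j).choose (L + 1)

theorem ballot_zero_right (L : ℕ) : ballot L 0 = 1 := by simp [ballot]

theorem ballot_succ_self (L : ℕ) : ballot L (L + 1) = 0 := by
  have : (L + (L + 1)).choose L = (L + (L + 1)).choose (L + 1) :=
    (Nat.choose_symm_of_eq_add (by ring)).symm
  simp [ballot, this]

theorem ballot_succ_succ (L j : ℕ) :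
    ballot (L + 1) (j + 1) = ballot (L + 1) j + ballot L (j + 1) := by
  have h1 := Nat.choose_succ_succ (L + 1 + j) L
  have h2 := Nat.choose_succ_succ (L + 1 + j) (L + 1)
  simp only [ballot, Nat.succ_eq_add_one] at *
  rw [show L + 1 + (j + 1) = L + 1 + j + 1 by ring, show L + (j + 1) = L + 1 + j by ring, h1, h2]
  push_cast
  ring

theorem sum_ballot (L n : ℕ) :
    ∑ j ∈ Finset.range (n + 1), ballot L j = ballot (L + 1) n := by
  induction n with
  | zero => simp [ballot_zero_right]
  | succ n ih => rw [Finset.sum_range_succ, ih, ballot_succ_succ]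

theorem ballot_mul (L j : ℕ) :
    ((L : ℤ) + 1) * ballot L j = ((L : ℤ) + 1 - j) * (L + j).choose L := by
  have h : (L + j).choose (L + 1) * (L + 1) = (L + j).choose L * j := by
    simpa using Nat.choose_succ_right_eq (L + j) L
  have h' : ((L + j).choose (L + 1) : ℤ) * (L + 1) = (L + j).choose L * j := by exact_mod_cast h
  unfold ballot
  linear_combination -h'

theorem ballot_nonneg {L j : ℕ} (h : j ≤ L) : 0 ≤ ballot L j := by
  have h1 := ballot_mul L j
  have h2 : (0 : ℤ) ≤ ((L : ℤ) + 1 - j) * (L + j).choose L := by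
    apply mul_nonneg <;> [omega; positivity]
  rw [← h1] at h2
  exact nonneg_of_mul_nonneg_right h2 (by positivity)

theorem ballot_self (L : ℕ) : ballot L L = catalan L := by
  have h1 := ballot_mul L L
  have h2 : ((L : ℤ) + 1) * catalan L = L.centralBinom := by
    exact_mod_cast succ_mul_catalan_eq_centralBinom L
  rw [Nat.centralBinom_eq_two_mul_choose, two_mul] at h2
  have h3 : ((L : ℤ) + 1) ≠ 0 := by positivity
  apply mul_left_cancel₀ h3
  rw [h1, h2]
  ring

/-! ### The polynomials `Q` and their recursion -/

theorem Q_eq_sum_ballot (L : ℕ) (r : ℂ) :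
    Q L r = ∑ j ∈ Finset.range (L + 1), (ballot L j : ℂ) * r ^ j := by
  unfold Q
  refine Finset.sum_congr rfl fun j _ => ?_
  congr 1
  have h : ((L : ℂ) + 1) * ballot L j = ((L : ℂ) + 1 - j) * (L + j).choose L := by
    exact_mod_cast ballot_mul L j
  have h3 : ((L : ℂ) + 1) ≠ 0 := Nat.cast_add_one_ne_zero L
  rw [div_mul_eq_mul_div, ← h, mul_div_cancel_left₀ _ h3]

theorem Q_zero (r : ℂ) : Q 0 r = 1 := by simp [Q]

/-- Pascal's rule for ballot numbers, summed against powers of r. The Catalan term is the top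
coefficient `ballot (L + 1) (L + 1)`, which the shifted sum lacks; `ballot L (L + 1) = 0` lets Q_L
absorb one extra index. -/
theorem one_sub_mul_Q_succ (L : ℕ) (r : ℂ) :
    (1 - r) * Q (L + 1) r = Q L r - catalan (L + 1) * r ^ (L + 2) := by
  have h1 : Q (L + 1) r = Q L r + r * (Q (L + 1) r - catalan (L + 1) * r ^ (L + 1)) := by
    have e1 : Q (L + 1) r - catalan (L + 1) * r ^ (L + 1)
        = ∑ j ∈ Finset.range (L + 1), (ballot (L + 1) j : ℂ) * r ^ j := by
      rw [Q_eq_sum_ballot, Finset.sum_range_succ, ballot_self]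
      push_cast
      ring
    have e2 : Q L r = 1 + ∑ j ∈ Finset.range (L + 1), (ballot L (j + 1) : ℂ) * r ^ (j + 1) := by
      rw [Q_eq_sum_ballot, Finset.sum_range_succ', Finset.sum_range_succ, ballot_succ_self,
        ballot_zero_right]
      push_cast
      ring
    have e3 : Q (L + 1) r
        = 1 + ∑ j ∈ Finset.range (L + 1), (ballot (L + 1) (j + 1) : ℂ) * r ^ (j + 1) := by
      rw [Q_eq_sum_ballot, Finset.sum_range_succ', ballot_zero_right]
      push_cast
      ring
    rw [e1, e2, e3, Finset.mul_sum, add_assoc, ← Finset.sum_add_distrib]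
    congr 1
    refine Finset.sum_congr rfl fun j _ => ?_
    rw [ballot_succ_succ]
    push_cast
    ring
  linear_combination h1

theorem Q_apply_zero (L : ℕ) : Q L 0 = 1 := by
  rw [Q_eq_sum_ballot, Finset.sum_range_succ']
  simp [ballot_zero_right]

theorem Q_ofReal (L : ℕ) (r : ℝ) :
    Q L (r : ℂ) = ((∑ j ∈ Finset.range (L + 1), (ballot L j : ℝ) * r ^ j : ℝ) : ℂ) := by
  rw [Q_eq_sum_ballot]
  push_cast
  rfl

theorem sum_ballot_mul_pow_pos (L : ℕ) {r : ℝ} (hr : 0 ≤ r) :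
    0 < ∑ j ∈ Finset.range (L + 1), (ballot L j : ℝ) * r ^ j := by
  rw [Finset.sum_range_succ', ballot_zero_right]
  have : 0 ≤ ∑ j ∈ Finset.range L, (ballot L (j + 1) : ℝ) * r ^ (j + 1) := by
    refine Finset.sum_nonneg fun j hj => mul_nonneg ?_ (by positivity)
    exact_mod_cast ballot_nonneg (Finset.mem_range.mp hj)
  simp only [Int.cast_one, pow_zero, mul_one]
  linarith

theorem differentiable_Q (L : ℕ) : Differentiable ℂ (Q L) := by
  unfold Q
  fun_prop

theorem analyticAt_Q (L : ℕ) (z : ℂ) : AnalyticAt ℂ (Q L) z :=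
  (differentiable_Q L).analyticAt z

/-! ### Taylor expansion of the current at zero -/

theorem analyticAt_current_zero (L : ℕ) : AnalyticAt ℂ (current L) 0 := by
  unfold current
  exact (analyticAt_id.mul (analyticAt_Q _ _)).div (analyticAt_Q _ _) (by simp [Q_apply_zero])

theorem current_succ_sub (L : ℕ) {r : ℂ} (h : Q (L + 1) r ≠ 0) :
    current (L + 1) r - r * (1 - r) = r ^ (L + 3) * (catalan (L + 1) / Q (L + 1) r) := by
  unfold current
  rw [Nat.add_sub_cancel]
  field_simp
  linear_combination (-r) * one_sub_mul_Q_succ L r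

theorem eventually_current_sub {L : ℕ} (hL : 1 ≤ L) :
    ∀ᶠ r : ℂ in 𝓝 0, current L r - r * (1 - r) = r ^ (L + 2) * (catalan L / Q L r) := by
  obtain ⟨n, rfl⟩ := Nat.exists_eq_add_of_le' hL
  have : ∀ᶠ r in 𝓝 0, Q (n + 1) r ≠ 0 :=
    (analyticAt_Q _ 0).continuousAt.eventually_ne (by simp [Q_apply_zero])
  filter_upwards [this] with r hr using current_succ_sub n hr

theorem taylor_current {L : ℕ} (hL : 1 ≤ L) :
    AnalyticAt ℂ (current L) 0 ∧
      (∀ k : ℕ, k ≤ L + 1 →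
        iteratedDeriv k (current L) 0 = iteratedDeriv k (fun r : ℂ => r * (1 - r)) 0) ∧
      (fun r : ℂ => current L r - r * (1 - r)) =O[𝓝 0] (fun r : ℂ => r ^ (L + 2)) := by
  have hA := analyticAt_current_zero L
  have hP : AnalyticAt ℂ (fun r : ℂ => r * (1 - r)) 0 := by fun_prop
  have hH : AnalyticAt ℂ (fun r : ℂ => (catalan L : ℂ) / Q L r) 0 :=
    analyticAt_const.div (analyticAt_Q _ _) (by simp [Q_apply_zero])
  have hev := eventually_current_sub hL
  refine ⟨hA, fun k hk => ?_, ?_⟩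
  -- The difference vanishes to order at least L + 2, because the cofactor C_L / Q_L is analytic at
  -- 0, where Q_L = 1.
  · have ho : ((L + 2 : ℕ) : ℕ∞) ≤ analyticOrderAt (current L - fun r : ℂ => r * (1 - r)) 0 := by
      rw [natCast_le_analyticOrderAt (hA.sub hP)]
      exact ⟨_, hH, by simpa using hev⟩
    rw [natCast_le_analyticOrderAt_iff_iteratedDeriv_eq_zero (hA.sub hP)] at ho
    have := ho k (by omega)
    rw [iteratedDeriv_sub hA.contDiffAt hP.contDiffAt] at this
    exact sub_eq_zero.mp this
  · refine (Asymptotics.IsBigO.congr' ?_ (hev.mono fun r hr => hr.symm) EventuallyEq.rfl)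
    simpa using (Asymptotics.isBigO_refl (fun r : ℂ => r ^ (L + 2)) (𝓝 0)).mul
      (hH.continuousAt.isBigO_one ℂ)

/-! ### Scaled Catalan numbers -/

/-- `catalan k / 4 ^ k`. -/
noncomputable def scaledCatalan (k : ℕ) : ℝ := catalan k / 4 ^ k

theorem catalan_succ_rec (n : ℕ) : (n + 2) * catalan (n + 1) = 2 * (2 * n + 1) * catalan n := by
  have h1 := succ_mul_catalan_eq_centralBinom n
  have h2 := succ_mul_catalan_eq_centralBinom (n + 1)
  have h3 := Nat.succ_mul_centralBinom_succ n
  rw [← h1, ← h2] at h3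
  apply Nat.eq_of_mul_eq_mul_left (Nat.succ_pos n)
  simp only [Nat.succ_eq_add_one]
  linarith

theorem catalan_pos (n : ℕ) : 0 < catalan n := by
  have h := succ_mul_catalan_eq_centralBinom n
  have := Nat.centralBinom_pos n
  rw [← h] at this
  exact Nat.pos_of_mul_pos_left this

theorem scaledCatalan_pos (k : ℕ) : 0 < scaledCatalan k := by
  have := catalan_pos k
  unfold scaledCatalan
  positivity

theorem scaledCatalan_succ_rec (k : ℕ) :
    (2 * k + 4) * scaledCatalan (k + 1) = (2 * k + 1) * scaledCatalan k := by
  have h : ((k : ℝ) + 2) * catalan (k + 1) = 2 * (2 * k + 1) * catalan k := by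
    exact_mod_cast catalan_succ_rec k
  unfold scaledCatalan
  rw [pow_succ]
  field_simp
  linear_combination 2 * h

theorem scaledCatalan_succ (k : ℕ) :
    scaledCatalan (k + 1) = (2 * k + 1) / (2 * k + 4) * scaledCatalan k := by
  have := scaledCatalan_succ_rec k
  field_simp
  linarith

/-- This closed form yields at once that the sequence decreases, that it is convex, and that its
differences are negligible relative to its terms. -/
theorem scaledCatalan_sub_succ (k : ℕ) :
    scaledCatalan k - scaledCatalan (k + 1) = 3 / (2 * k + 4) * scaledCatalan k := by
  rw [scaledCatalan_succ]
  field_simp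
  ring

theorem scaledCatalan_antitone : Antitone scaledCatalan :=
  antitone_nat_of_succ_le fun k => by
    have := scaledCatalan_sub_succ k
    have h := scaledCatalan_pos k
    have : 0 ≤ 3 / (2 * k + 4) * scaledCatalan k := by positivity
    linarith

theorem scaledCatalan_sub_succ_antitone :
    Antitone fun k => scaledCatalan k - scaledCatalan (k + 1) := by
  intro m n h
  simp only [scaledCatalan_sub_succ]
  have := scaledCatalan_antitone h
  have := (scaledCatalan_pos n).le
  have : (m : ℝ) ≤ n := by exact_mod_cast h
  gcongr

/-- Serves twice: it bounds the Catalan series by 2 on the closed disc, and it evaluates the partial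
sums exactly at r = 1/2. -/
theorem sum_scaledCatalan (n : ℕ) :
    ∑ k ∈ Finset.range n, scaledCatalan k = 2 - (2 * n + 2) * scaledCatalan n := by
  induction n with
  | zero => simp [scaledCatalan]
  | succ n ih =>
    rw [Finset.sum_range_succ, ih]
    push_cast
    linear_combination scaledCatalan_succ_rec n

theorem summable_scaledCatalan : Summable scaledCatalan := by
  refine summable_of_sum_range_le (c := 2) (fun n => (scaledCatalan_pos n).le) fun n => ?_
  rw [sum_scaledCatalan]
  have := scaledCatalan_pos n
  have : 0 ≤ (2 * n + 2) * scaledCatalan n := by positivity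
  linarith

theorem tsum_scaledCatalan_le : ∑' k, scaledCatalan k ≤ 2 := by
  refine Real.tsum_le_of_sum_range_le (fun n => (scaledCatalan_pos n).le) fun n => ?_
  rw [sum_scaledCatalan]
  have := scaledCatalan_pos n
  have : 0 ≤ (2 * n + 2) * scaledCatalan n := by positivity
  linarith

theorem tendsto_scaledCatalan_ratio :
    Tendsto (fun k => scaledCatalan k / scaledCatalan (k + 1)) atTop (𝓝 1) := by
  have h : ∀ k : ℕ, 1 + 3 / (2 * (k : ℝ) + 1) = scaledCatalan k / scaledCatalan (k + 1) := by
    intro k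
    have := scaledCatalan_pos k
    rw [scaledCatalan_succ]
    field_simp
    ring
  refine Tendsto.congr h ?_
  have : Tendsto (fun k : ℕ => 2 * (k : ℝ) + 1) atTop atTop :=
    tendsto_atTop_add_const_right _ _
      (tendsto_natCast_atTop_atTop.const_mul_atTop (by norm_num))
  simpa using (this.const_div_atTop 3).const_add 1

theorem tendsto_scaledCatalan_sub_div :
    Tendsto (fun k => (scaledCatalan k - scaledCatalan (k + 1)) / scaledCatalan k)
      atTop (𝓝 0) := by
  have h : ∀ k : ℕ, 3 / (2 * (k : ℝ) + 4) =
      (scaledCatalan k - scaledCatalan (k + 1)) / scaledCatalan k := by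
    intro k
    have := (scaledCatalan_pos k).ne'
    rw [scaledCatalan_sub_succ]
    field_simp
  refine Tendsto.congr h ?_
  have : Tendsto (fun k : ℕ => 2 * (k : ℝ) + 4) atTop atTop :=
    tendsto_atTop_add_const_right _ _
      (tendsto_natCast_atTop_atTop.const_mul_atTop (by norm_num))
  exact this.const_div_atTop 3

theorem catalan_mul_pow (x : ℂ) (k : ℕ) :
    (catalan k : ℂ) * x ^ k = (scaledCatalan k : ℂ) * (4 * x) ^ k := by
  unfold scaledCatalan
  push_cast
  rw [mul_pow]
  field_simp

/-! ### Power series with monotone coefficients on the closed unit disc -/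

theorem summable_norm_ofReal_mul_pow {c : ℕ → ℝ} (hc : Summable c) (h0 : ∀ k, 0 ≤ c k) {y : ℂ}
    (hy : ‖y‖ ≤ 1) : Summable fun k => ‖(c k : ℂ) * y ^ k‖ := by
  refine Summable.of_nonneg_of_le (fun _ => norm_nonneg _) (fun k => ?_) hc
  rw [norm_mul, norm_pow, Complex.norm_of_nonneg (h0 k)]
  exact mul_le_of_le_one_right (h0 k) (pow_le_one₀ (norm_nonneg _) hy)

theorem norm_tsum_ofReal_mul_pow_le {c : ℕ → ℝ} (hc : Summable c) (h0 : ∀ k, 0 ≤ c k) {y : ℂ}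
    (hy : ‖y‖ ≤ 1) : ‖∑' k, (c k : ℂ) * y ^ k‖ ≤ ∑' k, c k := by
  refine (norm_tsum_le_tsum_norm (summable_norm_ofReal_mul_pow hc h0 hy)).trans ?_
  refine (summable_norm_ofReal_mul_pow hc h0 hy).tsum_le_tsum (fun k => ?_) hc
  rw [norm_mul, norm_pow, Complex.norm_of_nonneg (h0 k)]
  exact mul_le_of_le_one_right (h0 k) (pow_le_one₀ (norm_nonneg _) hy)

theorem one_sub_mul_tsum {c : ℕ → ℝ} (hc : Summable c) (h0 : ∀ k, 0 ≤ c k) {y : ℂ}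
    (hy : ‖y‖ ≤ 1) :
    (1 - y) * ∑' k, (c k : ℂ) * y ^ k
      = c 0 - y * ∑' k, ((c k - c (k + 1) : ℝ) : ℂ) * y ^ k := by
  have hs := (summable_norm_ofReal_mul_pow hc h0 hy).of_norm
  have hs1 := (summable_norm_ofReal_mul_pow ((summable_nat_add_iff 1).mpr hc)
    (fun k => h0 (k + 1)) hy).of_norm
  have e : ∑' k, ((c k - c (k + 1) : ℝ) : ℂ) * y ^ k
      = ∑' k, (c k : ℂ) * y ^ k - ∑' k, (c (k + 1) : ℂ) * y ^ k := by
    rw [← hs.tsum_sub hs1]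
    refine tsum_congr fun k => ?_
    push_cast
    ring
  have e2 : ∑' k, (c k : ℂ) * y ^ k = c 0 + y * ∑' k, (c (k + 1) : ℂ) * y ^ k := by
    rw [hs.tsum_eq_zero_add, ← tsum_mul_left]
    simp only [pow_zero, mul_one]
    congr 1
    refine tsum_congr fun k => ?_
    ring
  rw [e]
  linear_combination e2

/-- Summation by parts: the differences of c are nonnegative and telescope to c 0, since c is
summable. -/
theorem norm_one_sub_mul_tsum_le {c : ℕ → ℝ} (hc : Summable c) (h0 : ∀ k, 0 ≤ c k)
    (ha : Antitone c) {y : ℂ} (hy : ‖y‖ ≤ 1) :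
    ‖(1 - y) * ∑' k, (c k : ℂ) * y ^ k‖ ≤ 2 * c 0 := by
  have hd : Summable fun k => c k - c (k + 1) := hc.sub ((summable_nat_add_iff 1).mpr hc)
  have hd0 : ∀ k, 0 ≤ c k - c (k + 1) := fun k => sub_nonneg.mpr (ha (Nat.le_succ k))
  have hsum : ∑' k, (c k - c (k + 1)) = c 0 := by
    rw [hc.tsum_sub ((summable_nat_add_iff 1).mpr hc), hc.tsum_eq_zero_add]
    ring
  rw [one_sub_mul_tsum hc h0 hy]
  refine (norm_sub_le _ _).trans ?_
  rw [norm_mul, Complex.norm_of_nonneg (h0 0), two_mul]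
  have h1 := norm_tsum_ofReal_mul_pow_le hd hd0 hy
  rw [hsum] at h1
  have h2 : ‖y‖ * ‖∑' k, ((c k - c (k + 1) : ℝ) : ℂ) * y ^ k‖ ≤ 1 * c 0 :=
    mul_le_mul hy h1 (norm_nonneg _) zero_le_one
  linarith

/-- The normalized tail `∑ k, c (n + k) y ^ k` of the scaled Catalan series. -/
noncomputable def catalanTail (y : ℂ) (n : ℕ) : ℂ := ∑' k, (scaledCatalan (n + k) : ℂ) * y ^ k

theorem summable_scaledCatalan_add (n : ℕ) : Summable fun k => scaledCatalan (n + k) := by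
  simpa only [add_comm n] using (summable_nat_add_iff n).mpr summable_scaledCatalan

/-- Two summations by parts. The first leaves c_n - y V_n, where V_n has the differences of c as
coefficients; these decrease by convexity, so the second bounds (1 - y) V_n by 2(c_n - c_{n+1}) =
o(c_n). This works up to the circle |y| = 1, except at y = 1. -/
theorem tendsto_catalanTail_div {y : ℂ} (hy : ‖y‖ ≤ 1) (hy1 : y ≠ 1) :
    Tendsto (fun n => catalanTail y n / scaledCatalan n) atTop (𝓝 (1 / (1 - y))) := by
  have hy' : 1 - y ≠ 0 := sub_ne_zero.mpr hy1.symm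
  set V : ℕ → ℂ := fun n =>
    ∑' k, ((scaledCatalan (n + k) - scaledCatalan (n + k + 1) : ℝ) : ℂ) * y ^ k with hV
  have hW : ∀ n, (1 - y) * catalanTail y n = scaledCatalan n - y * V n := fun n =>
    one_sub_mul_tsum (summable_scaledCatalan_add n) (fun k => (scaledCatalan_pos _).le) hy
  have hVle : ∀ n, ‖(1 - y) * V n‖ ≤ 2 * (scaledCatalan n - scaledCatalan (n + 1)) := by
    intro n
    refine norm_one_sub_mul_tsum_le (c := fun k => scaledCatalan (n + k) - scaledCatalan (n + k + 1))
      ((summable_scaledCatalan_add n).sub ?_) (fun k => ?_) (fun a b hab => ?_) hy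
    · simpa only [add_right_comm] using summable_scaledCatalan_add (n + 1)
    · exact sub_nonneg.mpr (scaledCatalan_antitone (Nat.le_succ _))
    · exact scaledCatalan_sub_succ_antitone (Nat.add_le_add_left hab n)
  have hV0 : Tendsto (fun n => (1 - y) * V n / scaledCatalan n) atTop (𝓝 0) := by
    have := tendsto_scaledCatalan_sub_div.const_mul 2
    rw [mul_zero] at this
    refine squeeze_zero_norm (fun n => ?_) this
    rw [norm_div, Complex.norm_of_nonneg (scaledCatalan_pos n).le, ← mul_div_assoc]
    exact div_le_div_of_nonneg_right (hVle n) (scaledCatalan_pos n).le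
  have hlim := ((hV0.const_mul y).const_sub (1 - y)).div_const ((1 - y) ^ 2)
  have e : ((1 - y) - y * 0) / (1 - y) ^ 2 = 1 / (1 - y) := by
    field_simp
    ring
  rw [e] at hlim
  refine hlim.congr fun n => ?_
  have hc : (scaledCatalan n : ℂ) ≠ 0 := by exact_mod_cast (scaledCatalan_pos n).ne'
  field_simp
  linear_combination -hW n

theorem eventually_catalanTail_ne_zero {y : ℂ} (hy : ‖y‖ ≤ 1) (hy1 : y ≠ 1) :
    ∀ᶠ n in atTop, catalanTail y n ≠ 0 := by
  have hy' : 1 - y ≠ 0 := sub_ne_zero.mpr hy1.symm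
  filter_upwards [(tendsto_catalanTail_div hy hy1).eventually_ne (one_div_ne_zero hy')] with n hn h
  simp [h] at hn

theorem tendsto_catalanTail_ratio {y : ℂ} (hy : ‖y‖ ≤ 1) (hy1 : y ≠ 1) :
    Tendsto (fun n => catalanTail y n / catalanTail y (n + 1)) atTop (𝓝 1) := by
  have hy' : 1 - y ≠ 0 := sub_ne_zero.mpr hy1.symm
  have h1 := tendsto_catalanTail_div hy hy1
  have h2 := h1.comp (tendsto_add_atTop_nat 1)
  have h3 : Tendsto (fun k => ((scaledCatalan k / scaledCatalan (k + 1) : ℝ) : ℂ)) atTop (𝓝 1) := by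
    exact_mod_cast (Complex.continuous_ofReal.tendsto 1).comp tendsto_scaledCatalan_ratio
  have h4 := (h1.div h2 (one_div_ne_zero hy')).mul h3
  rw [div_self (one_div_ne_zero hy'), one_mul] at h4
  refine h4.congr fun n => ?_
  have hc : (scaledCatalan n : ℂ) ≠ 0 := by exact_mod_cast (scaledCatalan_pos n).ne'
  have hc' : (scaledCatalan (n + 1) : ℂ) ≠ 0 := by exact_mod_cast (scaledCatalan_pos _).ne'
  simp only [Function.comp, Pi.div_apply]
  push_cast
  by_cases h : catalanTail y (n + 1) = 0
  · simp [h]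
  · field_simp

/-! ### The Catalan generating function -/

/-- The generating function of the Catalan numbers, on the closed disc of radius `1/4`. -/
noncomputable def catalanSeries (x : ℂ) : ℂ := ∑' k, (catalan k : ℂ) * x ^ k

theorem summable_norm_catalan_mul_pow {x : ℂ} (hx : ‖x‖ ≤ 1 / 4) :
    Summable fun k => ‖(catalan k : ℂ) * x ^ k‖ := by
  simp only [catalan_mul_pow]
  refine summable_norm_ofReal_mul_pow summable_scaledCatalan (fun k => (scaledCatalan_pos k).le) ?_
  rw [norm_mul]
  norm_num
  linarith

theorem norm_catalanSeries_le {x : ℂ} (hx : ‖x‖ ≤ 1 / 4) : ‖catalanSeries x‖ ≤ 2 := by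
  unfold catalanSeries
  simp only [catalan_mul_pow]
  refine (norm_tsum_ofReal_mul_pow_le summable_scaledCatalan
    (fun k => (scaledCatalan_pos k).le) ?_).trans tsum_scaledCatalan_le
  rw [norm_mul]
  norm_num
  linarith

theorem catalanSeries_eq {x : ℂ} (hx : ‖x‖ ≤ 1 / 4) :
    catalanSeries x = 1 + x * catalanSeries x ^ 2 := by
  have hs := summable_norm_catalan_mul_pow hx
  have h2 : catalanSeries x ^ 2 = ∑' n, (catalan (n + 1) : ℂ) * x ^ n := by
    rw [sq, catalanSeries, tsum_mul_tsum_eq_tsum_sum_antidiagonal_of_summable_norm hs hs]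
    refine tsum_congr fun n => ?_
    rw [catalan_succ']
    push_cast
    rw [Finset.sum_mul]
    refine Finset.sum_congr rfl fun p hp => ?_
    rw [← Finset.HasAntidiagonal.mem_antidiagonal.mp hp, pow_add]
    ring
  rw [h2, catalanSeries, hs.of_norm.tsum_eq_zero_add, ← tsum_mul_left]
  simp only [catalan_zero, Nat.cast_one, pow_zero, mul_one]
  congr 1
  refine tsum_congr fun k => ?_
  ring

/-- The quadratic equation C = 1 + x C² splits when x = r(1 - r), with roots 1/r and 1/(1 - r). -/
theorem catalanSeries_factor {r : ℂ} (hx : ‖r * (1 - r)‖ ≤ 1 / 4) :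
    (r * catalanSeries (r * (1 - r)) - 1) * ((1 - r) * catalanSeries (r * (1 - r)) - 1) = 0 := by
  linear_combination -catalanSeries_eq hx

theorem catalanSeries_of_norm_lt {r : ℂ} (hx : ‖r * (1 - r)‖ ≤ 1 / 4) (hr : ‖r‖ < 1 / 2) :
    (1 - r) * catalanSeries (r * (1 - r)) = 1 := by
  rcases mul_eq_zero.mp (catalanSeries_factor hx) with h | h
  -- The root 1/r is excluded by size: |C| ≤ 2 and |r| < 1/2 give |r C| < 1.
  · exfalso
    have h1 : ‖r * catalanSeries (r * (1 - r))‖ = 1 := by rw [sub_eq_zero.mp h, norm_one]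
    rw [norm_mul] at h1
    nlinarith [norm_catalanSeries_le hx, norm_nonneg r, norm_nonneg (catalanSeries (r * (1 - r)))]
  · exact sub_eq_zero.mp h

/-! ### Limits of the current -/

/-- `(1 - r) ^ (L + 1) * Q L r`, in terms of the partial sums of the Catalan series. -/
noncomputable def normalizedQ (r : ℂ) (L : ℕ) : ℂ :=
  1 - r * ∑ k ∈ Finset.range (L + 1), (catalan k : ℂ) * (r * (1 - r)) ^ k

theorem normalizedQ_succ (r : ℂ) (L : ℕ) :
    normalizedQ r (L + 1)
      = normalizedQ r L - r * (catalan (L + 1) * (r * (1 - r)) ^ (L + 1)) := by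
  unfold normalizedQ
  rw [Finset.sum_range_succ _ (L + 1)]
  ring

theorem pow_mul_Q (r : ℂ) (L : ℕ) : (1 - r) ^ (L + 1) * Q L r = normalizedQ r L := by
  induction L with
  | zero => simp [normalizedQ, Q_zero]
  | succ L ih =>
    rw [normalizedQ_succ, ← ih, mul_pow]
    linear_combination (1 - r) ^ (L + 1) * one_sub_mul_Q_succ L r

theorem current_succ (L : ℕ) (r : ℂ) : current (L + 1) r = r * Q L r / Q (L + 1) r := rfl

theorem tendsto_current_of_normalizedQ {r ℓ : ℂ} (hr : r ≠ 1)
    (h0 : ∀ᶠ L in atTop, normalizedQ r L ≠ 0)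
    (h : Tendsto (fun L => normalizedQ r L / normalizedQ r (L + 1)) atTop (𝓝 ℓ)) :
    (∀ᶠ L in atTop, Q L r ≠ 0) ∧
      Tendsto (fun L => current L r) atTop (𝓝 (r * (1 - r) * ℓ)) := by
  have hr' : 1 - r ≠ 0 := sub_ne_zero.mpr hr.symm
  refine ⟨h0.mono fun L hL hQ => hL (by rw [← pow_mul_Q, hQ, mul_zero]), ?_⟩
  rw [← tendsto_add_atTop_iff_nat 1]
  refine (h.const_mul (r * (1 - r))).congr fun L => ?_
  rw [← pow_mul_Q, ← pow_mul_Q, current_succ]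
  -- If `Q (L + 1) r = 0`, both quotients are 0 by the convention for division by zero.
  by_cases hq : Q (L + 1) r = 0
  · simp [hq]
  · field_simp
    ring

theorem norm_lt_norm_one_sub {r : ℂ} (h : r.re < 1 / 2) : ‖r‖ < ‖1 - r‖ := by
  rw [Complex.norm_eq_sqrt_sq_add_sq, Complex.norm_eq_sqrt_sq_add_sq]
  apply Real.sqrt_lt_sqrt (by positivity)
  simp
  nlinarith

theorem norm_lt_half {r : ℂ} (hx : ‖r * (1 - r)‖ ≤ 1 / 4) (h : r.re < 1 / 2) : ‖r‖ < 1 / 2 := by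
  have h1 := norm_lt_norm_one_sub h
  rw [norm_mul] at hx
  nlinarith [norm_nonneg r]

theorem tendsto_current_inner {r : ℂ} (hx : ‖r * (1 - r)‖ < 1 / 4) (hre : r.re < 1 / 2) :
    (∀ᶠ L in atTop, Q L r ≠ 0) ∧ Tendsto (fun L => current L r) atTop (𝓝 (r * (1 - r))) := by
  have hn := norm_lt_half hx.le hre
  have hC := catalanSeries_of_norm_lt hx.le hn
  have hr1 : r ≠ 1 := by
    rintro rfl
    norm_num at hn
  have hr' : 1 - r ≠ 0 := sub_ne_zero.mpr hr1.symm
  have hl : Tendsto (normalizedQ r) atTop (𝓝 (1 - r * catalanSeries (r * (1 - r)))) :=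
    (((summable_norm_catalan_mul_pow hx.le).of_norm.hasSum.tendsto_sum_nat.comp
      (tendsto_add_atTop_nat 1)).const_mul r).const_sub 1
  -- With (1 - r) C = 1, a zero limit would also give r C = 1, hence r = 1/2.
  have hne : 1 - r * catalanSeries (r * (1 - r)) ≠ 0 := by
    intro h
    have : (1 - r) - r = 0 := by linear_combination (1 - r) * h + r * hC
    have := congrArg Complex.re this
    simp at this
    linarith
  have h2 := hl.div (hl.comp (tendsto_add_atTop_nat 1)) hne
  rw [div_self hne] at h2
  simpa using tendsto_current_of_normalizedQ hr1 (hl.eventually_ne hne) h2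

/-- At r = 1 the factor 1 - r kills one side of the recursion. This point needs separate treatment
because `normalizedQ` vanishes there. -/
theorem Q_one (L : ℕ) : Q L 1 = catalan (L + 1) := by
  linear_combination -one_sub_mul_Q_succ L 1

theorem catalan_ratio (L : ℕ) :
    (catalan L : ℂ) / catalan (L + 1)
      = 1 / 4 * ((scaledCatalan L / scaledCatalan (L + 1) : ℝ) : ℂ) := by
  have : (catalan (L + 1) : ℂ) ≠ 0 := by exact_mod_cast (catalan_pos _).ne'
  unfold scaledCatalan
  push_cast
  rw [pow_succ]
  field_simp

theorem tendsto_catalan_ratio :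
    Tendsto (fun L => (catalan L : ℂ) / catalan (L + 1)) atTop (𝓝 (1 / 4)) := by
  simp only [catalan_ratio]
  have := ((Complex.continuous_ofReal.tendsto 1).comp tendsto_scaledCatalan_ratio).const_mul
    (1 / 4 : ℂ)
  simpa [Function.comp_def] using this

theorem tendsto_current_one :
    (∀ᶠ L in atTop, Q L 1 ≠ 0) ∧ Tendsto (fun L => current L 1) atTop (𝓝 (1 / 4)) := by
  constructor
  · refine Eventually.of_forall fun L => ?_
    rw [Q_one]
    exact_mod_cast (catalan_pos _).ne'
  · rw [← tendsto_add_atTop_iff_nat 1]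
    refine (tendsto_catalan_ratio.comp (tendsto_add_atTop_nat 1)).congr fun L => ?_
    simp [current_succ, Q_one]

theorem tendsto_current_half :
    Tendsto (fun L => current L (1 / 2)) atTop (𝓝 (1 / 4)) := by
  have hT : ∀ L : ℕ, normalizedQ (1 / 2) L = (((L + 2) * scaledCatalan (L + 1) : ℝ) : ℂ) := by
    intro L
    have h := sum_scaledCatalan (L + 1)
    have h' : (∑ k ∈ Finset.range (L + 1), (scaledCatalan k : ℂ))
        = 2 - (2 * L + 4) * scaledCatalan (L + 1) := by
      rw [← Complex.ofReal_sum, h]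
      push_cast
      ring
    unfold normalizedQ
    have : ∀ k, (catalan k : ℂ) * (1 / 2 * (1 - 1 / 2)) ^ k = scaledCatalan k := by
      intro k
      rw [catalan_mul_pow]
      norm_num
    simp only [this, h']
    push_cast
    ring
  have hpos : ∀ L : ℕ, 0 < (L + 2) * scaledCatalan (L + 1) := fun L => by
    have := scaledCatalan_pos (L + 1)
    positivity
  have hlim : Tendsto (fun L => normalizedQ (1 / 2) L / normalizedQ (1 / 2) (L + 1))
      atTop (𝓝 1) := by
    have h1 : Tendsto (fun L : ℕ => ((L : ℝ) + 2) / (L + 3)) atTop (𝓝 1) := by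
      have : ∀ L : ℕ, 1 - 1 / ((L : ℝ) + 3) = ((L : ℝ) + 2) / (L + 3) := by
        intro L
        field_simp
        ring
      refine Tendsto.congr this ?_
      have := ((tendsto_natCast_atTop_atTop (R := ℝ)).atTop_add
        (tendsto_const_nhds (x := (3 : ℝ)))).const_div_atTop 1
      simpa using this.const_sub 1
    have h2 := h1.mul (tendsto_scaledCatalan_ratio.comp (tendsto_add_atTop_nat 1))
    rw [mul_one] at h2
    have h3 := (Complex.continuous_ofReal.tendsto 1).comp h2
    rw [Complex.ofReal_one] at h3
    refine h3.congr fun L => ?_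
    rw [hT, hT]
    simp only [Function.comp]
    push_cast
    rw [div_mul_div_comm]
    ring
  have hne : ∀ᶠ L in atTop, normalizedQ (1 / 2) L ≠ 0 := Eventually.of_forall fun L => by
    rw [hT]
    exact_mod_cast (hpos L).ne'
  have := (tendsto_current_of_normalizedQ (by norm_num) hne hlim).2
  norm_num at this ⊢
  exact this

theorem tendsto_current_right {r : ℂ} (hx : ‖r * (1 - r)‖ ≤ 1 / 4) (hre : 1 / 2 < r.re) :
    (∀ᶠ L in atTop, Q L r ≠ 0) ∧ Tendsto (fun L => current L r) atTop (𝓝 (1 / 4)) := by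
  rcases eq_or_ne r 1 with rfl | hr1
  · exact tendsto_current_one
  have hr' : 1 - r ≠ 0 := sub_ne_zero.mpr hr1.symm
  have hr0 : r ≠ 0 := by
    rintro rfl
    norm_num at hre
  -- The reflection r ↦ 1 - r preserves x and moves r to the left lobe, so here r C(x) = 1 and T_L
  -- reduces to a tail.
  have hx' : ‖(1 - r) * (1 - (1 - r))‖ ≤ 1 / 4 := by
    rwa [sub_sub_cancel, mul_comm]
  have hC := catalanSeries_of_norm_lt hx' (norm_lt_half hx' (by simp; linarith))
  rw [sub_sub_cancel, mul_comm (1 - r)] at hC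
  set y : ℂ := 4 * (r * (1 - r)) with hy
  have hy0 : y ≠ 0 := mul_ne_zero (by norm_num) (mul_ne_zero hr0 hr')
  have hyn : ‖y‖ ≤ 1 := by
    rw [hy, norm_mul, Complex.norm_ofNat]
    linarith
  have hy1 : y ≠ 1 := by
    intro h
    -- 1 - 4x = (1 - 2r)², so y = 1 only at r = 1/2.
    have h2 : (1 - 2 * r) ^ 2 = 0 := by linear_combination -h + hy
    have := congrArg Complex.re (pow_eq_zero_iff (two_ne_zero) |>.mp h2)
    simp at this
    linarith
  have hT : ∀ L, normalizedQ r L = r * y ^ (L + 1) * catalanTail y (L + 1) := by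
    intro L
    have hs := (summable_norm_catalan_mul_pow hx).of_norm.sum_add_tsum_nat_add (L + 1)
    have e : ∑' k, (catalan (k + (L + 1)) : ℂ) * (r * (1 - r)) ^ (k + (L + 1))
        = y ^ (L + 1) * catalanTail y (L + 1) := by
      unfold catalanTail
      rw [← tsum_mul_left]
      refine tsum_congr fun k => ?_
      rw [catalan_mul_pow, ← hy, pow_add, add_comm k]
      ring
    rw [e] at hs
    rw [catalanSeries] at hC
    rw [normalizedQ]
    linear_combination -r * hs - hC
  have hev : ∀ᶠ L in atTop, catalanTail y (L + 1) ≠ 0 :=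
    (tendsto_add_atTop_nat 1).eventually (eventually_catalanTail_ne_zero hyn hy1)
  have hlim : Tendsto (fun L => normalizedQ r L / normalizedQ r (L + 1)) atTop (𝓝 (1 / y)) := by
    have := ((tendsto_catalanTail_ratio hyn hy1).comp (tendsto_add_atTop_nat 1)).div_const y
    refine this.congr fun L => ?_
    rw [hT, hT, Function.comp, pow_succ y (L + 1)]
    by_cases h : catalanTail y (L + 1 + 1) = 0
    · simp [h]
    · field_simp
  have hne : ∀ᶠ L in atTop, normalizedQ r L ≠ 0 := hev.mono fun L hL => by
    rw [hT]
    positivity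
  have := tendsto_current_of_normalizedQ hr1 hne hlim
  convert this using 3
  rw [hy]
  field_simp

/-- A sequence with `x (n + 1) ≤ ρ * x n + ε n`, where `ρ < 1` and `ε → 0`, tends to zero. -/
theorem tendsto_zero_of_le_mul_add {x ε : ℕ → ℝ} {ρ : ℝ} (hx : ∀ n, 0 ≤ x n) (hρ0 : 0 ≤ ρ)
    (hρ : ρ < 1) (hε : Tendsto ε atTop (𝓝 0)) (h : ∀ᶠ n in atTop, x (n + 1) ≤ ρ * x n + ε n) :
    Tendsto x atTop (𝓝 0) := by
  rw [Metric.tendsto_atTop]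
  intro δ hδ
  -- Chosen so that δ/2 is the fixed point of t ↦ ρ t + δ(1 - ρ)/2.
  have hδ' : 0 < δ * (1 - ρ) / 2 := by nlinarith
  obtain ⟨N, hN⟩ := eventually_atTop.mp (h.and (hε.eventually_lt_const hδ'))
  have hb : ∀ m, x (N + m) ≤ ρ ^ m * x N + δ / 2 := by
    intro m
    induction m with
    | zero => simp; linarith
    | succ m ih =>
      obtain ⟨h1, h2⟩ := hN (N + m) (by omega)
      rw [← add_assoc, pow_succ]
      nlinarith [mul_le_mul_of_nonneg_left ih hρ0]
  have hp : Tendsto (fun m => ρ ^ m * x N) atTop (𝓝 0) := by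
    simpa using (tendsto_pow_atTop_nhds_zero_of_lt_one hρ0 hρ).mul_const (x N)
  obtain ⟨M, hM⟩ := eventually_atTop.mp (hp.eventually_lt_const (half_pos hδ))
  refine ⟨N + M, fun n hn => ?_⟩
  obtain ⟨m, rfl⟩ := Nat.exists_eq_add_of_le hn
  rw [Real.dist_eq, sub_zero, abs_of_nonneg (hx _), add_assoc]
  have := hb (M + m)
  have := hM (M + m) (by omega)
  linarith

/-- Convergence of an asymptotically affine contraction to its fixed point. -/
theorem tendsto_of_affine_contraction {u a : ℕ → ℂ} {α b : ℂ} (hα : ‖α‖ < 1)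
    (ha : Tendsto a atTop (𝓝 α)) (h : ∀ n, u (n + 1) = a n * u n + b) :
    Tendsto u atTop (𝓝 (b / (1 - α))) := by
  have hα1 : 1 - α ≠ 0 := by
    intro h
    rw [← sub_eq_zero.mp h] at hα
    norm_num at hα
  set w := b / (1 - α) with hw
  have hwb : b = (1 - α) * w := by rw [hw]; field_simp
  obtain ⟨ρ, hρ, hρ1⟩ := exists_between hα
  rw [tendsto_iff_norm_sub_tendsto_zero]
  have hε : Tendsto (fun n => ‖(a n - α) * w‖) atTop (𝓝 0) := by
    simpa using ((ha.sub_const α).mul_const w).norm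
  refine tendsto_zero_of_le_mul_add (fun _ => norm_nonneg _) ((norm_nonneg _).trans hρ.le) hρ1 hε ?_
  filter_upwards [ha.norm.eventually_lt_const hρ] with n hn
  have e : u (n + 1) - w = a n * (u n - w) + (a n - α) * w := by
    rw [h n, hwb]
    ring
  rw [e]
  refine (norm_add_le _ _).trans ?_
  rw [norm_mul (a n)]
  gcongr

theorem tendsto_current_far {r : ℂ} (hx : 1 / 4 < ‖r * (1 - r)‖) :
    (∀ᶠ L in atTop, Q L r ≠ 0) ∧ Tendsto (fun L => current L r) atTop (𝓝 (1 / 4)) := by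
  set x := r * (1 - r) with hxd
  have hx0 : x ≠ 0 := by
    intro h
    rw [h, norm_zero] at hx
    norm_num at hx
  have hr0 : r ≠ 0 := left_ne_zero_of_mul hx0
  have hr1 : r ≠ 1 := by
    rintro rfl
    simp [hxd] at hx0
  have hc : ∀ n, (catalan n : ℂ) ≠ 0 := fun n => by exact_mod_cast (catalan_pos n).ne'
  -- Measured against the last term of the sum, T_L satisfies u_{L+1} = a_L u_L - r with a_L →
  -- 1/(4x), a contraction exactly because |x| > 1/4. Its fixed point is nonzero, so u_L / u_{L+1} →
  -- 1.
  set u : ℕ → ℂ := fun L => normalizedQ r L / (catalan L * x ^ L) with hu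
  set a : ℕ → ℂ := fun L => catalan L / catalan (L + 1) / x with had
  have ha : Tendsto a atTop (𝓝 (1 / 4 / x)) := tendsto_catalan_ratio.div_const x
  have hα : ‖1 / 4 / x‖ < 1 := by
    rw [norm_div, div_lt_one (norm_pos_iff.mpr hx0)]
    norm_num
    linarith
  have hrec : ∀ n, u (n + 1) = a n * u n + -r := by
    intro n
    have := hc n
    have := hc (n + 1)
    simp only [hu, had, normalizedQ_succ, ← hxd]
    field_simp
    ring
  have hlim := tendsto_of_affine_contraction hα ha hrec
  have hα1 : 1 - 1 / 4 / x ≠ 0 := by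
    intro h
    rw [← sub_eq_zero.mp h] at hα
    norm_num at hα
  have hne : -r / (1 - 1 / 4 / x) ≠ 0 := div_ne_zero (neg_ne_zero.mpr hr0) hα1
  have hev : ∀ᶠ L in atTop, normalizedQ r L ≠ 0 := by
    filter_upwards [hlim.eventually_ne hne] with L hL h
    simp [hu, h] at hL
  have h2 := (hlim.div (hlim.comp (tendsto_add_atTop_nat 1)) hne).mul ha
  rw [div_self hne, one_mul] at h2
  have h3 : Tendsto (fun L => normalizedQ r L / normalizedQ r (L + 1)) atTop (𝓝 (1 / 4 / x)) := by
    refine h2.congr fun L => ?_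
    have := hc L
    have := hc (L + 1)
    simp only [hu, had, Function.comp, Pi.div_apply]
    by_cases h : normalizedQ r (L + 1) = 0
    · simp [h]
    · field_simp
      ring
  have := tendsto_current_of_normalizedQ hr1 hev h3
  convert this using 3
  rw [← hxd]
  field_simp

/-! ### The critical value -/

theorem exists_limit_current :
    ∃ j : ℝ → ℝ,
      (∀ r : ℝ, 0 ≤ r → Tendsto (fun L : ℕ => current L (r : ℂ)) atTop (𝓝 (j r : ℂ))) ∧
      (∀ c : ℝ, IsCriticalValue j c ↔ c = 1 / 2) := by
  refine ⟨fun r => if r < 1 / 2 then r * (1 - r) else 1 / 4, fun r hr => ?_, fun c => ?_⟩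
  · have hn : ‖(r : ℂ) * (1 - r)‖ = |r * (1 - r)| := by
      rw [← Real.norm_eq_abs, ← Complex.norm_real]
      push_cast
      rfl
    rcases lt_trichotomy r (1 / 2) with h | h | h
    · have hx : ‖(r : ℂ) * (1 - r)‖ < 1 / 4 := by
        rw [hn, abs_of_nonneg (by nlinarith)]
        nlinarith
      have := (tendsto_current_inner hx (by simpa using h)).2
      simpa only [if_pos h, Complex.ofReal_mul, Complex.ofReal_sub, Complex.ofReal_one] using this
    · subst h
      simpa using tendsto_current_half
    · have : Tendsto (fun L : ℕ => current L (r : ℂ)) atTop (𝓝 (1 / 4)) := by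
        rcases le_or_gt ‖(r : ℂ) * (1 - r)‖ (1 / 4) with h' | h'
        · exact (tendsto_current_right h' (by simpa using h)).2
        · exact (tendsto_current_far h').2
      simp only [if_neg h.le.not_gt]
      simpa using this
  · constructor
    · rintro ⟨h0, h1, h2⟩
      rcases lt_trichotomy c (1 / 2) with h | h | h
      · have := h2 ((c + 1 / 2) / 2) (by linarith)
        simp only [if_pos (show (c + 1 / 2) / 2 < 1 / 2 by linarith)] at this
        nlinarith
      · exact h
      -- A larger c fails at r = 1/2 itself, where the limit is already 1/4.
      · have := h1 (1 / 2) (by norm_num) h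
        norm_num at this
    · rintro rfl
      refine ⟨by norm_num, fun r _ hr => ?_, fun r hr => ?_⟩
      · simp only [if_pos hr]
        nlinarith
      · simp only [if_neg hr.le.not_gt]

/-! ### The curve -/

theorem norm_sq_mul_one_sub (r : ℂ) :
    ‖r * (1 - r)‖ ^ 2 = (r.re ^ 2 + r.im ^ 2) * ((1 - r.re) ^ 2 + r.im ^ 2) := by
  rw [norm_mul, mul_pow, Complex.sq_norm, Complex.sq_norm, Complex.normSq_apply,
    Complex.normSq_apply]
  simp
  ring

theorem norm_eq_quarter_iff (r : ℂ) : ‖r * (1 - r)‖ = 1 / 4 ↔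
    (r.re ^ 2 + r.im ^ 2) * ((1 - r.re) ^ 2 + r.im ^ 2) = 1 / 16 := by
  rw [← norm_sq_mul_one_sub, ← sq_eq_sq₀ (norm_nonneg _) (by norm_num)]
  norm_num

theorem norm_lt_quarter_iff (r : ℂ) : ‖r * (1 - r)‖ < 1 / 4 ↔
    (r.re ^ 2 + r.im ^ 2) * ((1 - r.re) ^ 2 + r.im ^ 2) < 1 / 16 := by
  rw [← norm_sq_mul_one_sub, ← sq_lt_sq₀ (norm_nonneg _) (by norm_num)]
  norm_num

theorem quarter_lt_norm_iff (r : ℂ) : 1 / 4 < ‖r * (1 - r)‖ ↔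
    1 / 16 < (r.re ^ 2 + r.im ^ 2) * ((1 - r.re) ^ 2 + r.im ^ 2) := by
  rw [← norm_sq_mul_one_sub, ← sq_lt_sq₀ (by norm_num) (norm_nonneg _)]
  norm_num

/-- The parametrization of the left lobe by the circle `‖4 * r * (1 - r)‖ = 1`. -/
theorem isSimpleClosedCurve_Γ : IsSimpleClosedCurve Γ := by
  have hre : ∀ z : Circle, 0 ≤ (1 - (z : ℂ)).re := fun z => by
    have := (Complex.re_le_norm (z : ℂ)).trans_eq z.norm_coe
    simpa using this
  have hsq : ∀ z : Circle, ((1 - (z : ℂ)) ^ (2⁻¹ : ℂ)) ^ 2 = 1 - z := fun z => by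
    exact_mod_cast Complex.cpow_nat_inv_pow (1 - (z : ℂ)) two_ne_zero
  have hroot : ∀ w : ℂ, 0 ≤ (w ^ (2⁻¹ : ℂ)).re := fun w => by
    rcases eq_or_ne w 0 with rfl | hw
    · simp
    rw [Complex.cpow_def_of_ne_zero hw, Complex.exp_re]
    refine mul_nonneg (Real.exp_nonneg _) (Real.cos_nonneg_of_mem_Icc ?_)
    have h1 := Complex.neg_pi_lt_log_im w
    have h2 := Complex.log_im_le_pi w
    have : (Complex.log w * 2⁻¹).im = (Complex.log w).im / 2 := by
      simp [Complex.mul_im]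
      ring
    rw [this]
    constructor <;> linarith
  -- The inverse of r ↦ 4r(1 - r) on Re r ≤ 1/2. The principal root has nonnegative real part, and
  -- it is continuous on Re ≥ 0, including the branch point 0.
  set γ : Circle → ℂ := fun z => (1 - (1 - (z : ℂ)) ^ (2⁻¹ : ℂ)) / 2 with hγ
  have hγz : ∀ z : Circle, (z : ℂ) = 4 * (γ z * (1 - γ z)) := fun z => by
    simp only [hγ]
    linear_combination hsq z
  refine ⟨γ, ?_, fun z w h => ?_, ?_⟩
  · refine continuous_iff_continuousAt.mpr fun z => ?_
    have h1 : ContinuousAt (fun z : Circle => (1 - (z : ℂ))) z := by fun_prop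
    have h2 := (Complex.continuousAt_cpow_const_of_re_pos (w := (2⁻¹ : ℂ)) (Or.inl (hre z))
      (by norm_num)).comp (f := fun z : Circle => (1 - (z : ℂ))) h1
    exact (continuousAt_const.sub h2).div_const 2
  · apply Circle.ext
    rw [hγz z, hγz w, h]
  · ext r
    constructor
    · rintro ⟨z, rfl⟩
      refine ⟨?_, ?_⟩
      · have := z.norm_coe
        rw [hγz z, norm_mul, Complex.norm_ofNat] at this
        linarith
      · have := hroot (1 - (z : ℂ))
        simp only [hγ, Complex.div_ofNat_re, Complex.sub_re, Complex.one_re]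
        linarith
    · rintro ⟨h1, h2⟩
      have hz : ‖4 * (r * (1 - r))‖ = 1 := by
        rw [norm_mul, h1, Complex.norm_ofNat]
        norm_num
      refine ⟨⟨4 * (r * (1 - r)), mem_sphere_zero_iff_norm.mpr hz⟩, ?_⟩
      have e : 1 - 4 * (r * (1 - r)) = (1 - 2 * r) ^ 2 := by ring
      have hs : ((1 - 2 * r) ^ 2) ^ (2⁻¹ : ℂ) = 1 - 2 * r := by
        rcases h2.lt_or_eq with h | h
        · exact Complex.sq_cpow_two_inv (by simp; linarith)
        -- The curve meets the line Re r = 1/2 only at 1/2.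
        · have him : r.im = 0 := by
            rw [norm_eq_quarter_iff, h] at h1
            have : r.im ^ 2 * (r.im ^ 2 + 1 / 2) = 0 := by linear_combination h1
            rcases mul_eq_zero.mp this with h | h
            · exact pow_eq_zero_iff two_ne_zero |>.mp h
            · nlinarith
          have : r = 1 / 2 := Complex.ext (by simp [h]) (by simp [him])
          norm_num [this]
      simp only [hγ]
      rw [e, hs]
      ring

theorem half_mem_Γ : (1 / 2 : ℂ) ∈ Γ := by
  constructor <;> norm_num

/-! ### The two sides of the curve -/

/-- The open region enclosed by the curve. -/
def innerRegion : Set ℂ := {r | ‖r * (1 - r)‖ < 1 / 4 ∧ r.re < 1 / 2}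

/-- The open region left by the curve and the region it encloses. -/
def outerRegion : Set ℂ := {r | 1 / 4 < ‖r * (1 - r)‖ ∨ 1 / 2 < r.re}

theorem isOpen_innerRegion : IsOpen innerRegion :=
  (isOpen_lt (f := fun r : ℂ => ‖r * (1 - r)‖) (by fun_prop) continuous_const).and
    (isOpen_lt Complex.continuous_re continuous_const)

theorem isOpen_outerRegion : IsOpen outerRegion :=
  IsOpen.union (s₁ := {r : ℂ | 1 / 4 < ‖r * (1 - r)‖}) (s₂ := {r : ℂ | 1 / 2 < r.re})
    (isOpen_lt continuous_const (by fun_prop)) (isOpen_lt continuous_const Complex.continuous_re)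

theorem disjoint_innerRegion_outerRegion : Disjoint innerRegion outerRegion := by
  rw [Set.disjoint_left]
  rintro r ⟨h1, h2⟩ (h | h)
  · exact h.not_gt h1
  · exact h.not_gt h2

theorem compl_Γ_subset : Γᶜ ⊆ innerRegion ∪ outerRegion := by
  intro r hr
  by_contra! hn
  rw [Set.mem_union, not_or] at hn
  obtain ⟨h1, h2⟩ := hn
  simp only [outerRegion, Set.mem_ofPred_eq, not_or, not_lt] at h2
  simp only [innerRegion, Set.mem_ofPred_eq, not_and, not_lt] at h1
  refine hr ⟨h2.1.antisymm ?_, h2.2⟩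
  rcases h2.2.lt_or_eq with h | h
  · by_contra! hlt
    exact (h1 hlt).not_gt h
  -- On the line Re r = 1/2 one has |r(1 - r)| = 1/4 + (Im r)² ≥ 1/4.
  · by_contra! hlt
    rw [norm_lt_quarter_iff, h] at hlt
    nlinarith [sq_nonneg r.im, sq_nonneg (r.im ^ 2)]

theorem isBounded_innerRegion : Bornology.IsBounded innerRegion := by
  refine (Metric.isBounded_closedBall (x := (0 : ℂ)) (r := 1 / 2)).subset fun r hr => ?_
  rw [mem_closedBall_zero_iff]
  exact (norm_lt_half hr.1.le hr.2).le

theorem outside_subset : outside Γ ⊆ outerRegion := by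
  rintro r ⟨hr, hb⟩
  rcases compl_Γ_subset hr with h | h
  · exfalso
    refine hb (isBounded_innerRegion.subset ?_)
    refine isPreconnected_connectedComponentIn.subset_left_of_subset_union isOpen_innerRegion
      isOpen_outerRegion disjoint_innerRegion_outerRegion
      ((connectedComponentIn_subset _ _).trans compl_Γ_subset)
      ⟨r, mem_connectedComponentIn hr, h⟩
  · exact h

/-- The ray from a point of the outer region, away from `1 / 2`, avoids the curve. -/
theorem ray_notMem_Γ {r : ℂ} (hr : r ∈ outerRegion) {s : ℝ} (hs : 1 ≤ s) :
    1 / 2 + (s : ℂ) * (r - 1 / 2) ∉ Γ := by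
  rintro ⟨h1, h2⟩
  rw [norm_eq_quarter_iff] at h1
  set a := r.re - 1 / 2 with ha
  set b := r.im with hb
  have e1 : (1 / 2 + (s : ℂ) * (r - 1 / 2)).re = 1 / 2 + s * a := by
    simp [Complex.mul_re, ha]
  have e2 : (1 / 2 + (s : ℂ) * (r - 1 / 2)).im = s * b := by
    simp [Complex.mul_im, hb]
  rw [e1] at h2
  rw [e1, e2] at h1
  rcases hr with h | h
  · rw [quarter_lt_norm_iff, show r.re = a + 1 / 2 by rw [ha]; ring] at h
    -- Centred at 1/2, |r(1 - r)|² - 1/16 = (a² + b²)² - (a² - b²)/2. Under dilation by s only the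
    -- quartic part gains the factor s² left inside the bracket, so positivity persists for s ≥ 1.
    have h3 : s ^ 2 * (s ^ 2 * (a ^ 2 + b ^ 2) ^ 2 - (a ^ 2 - b ^ 2) / 2) = 0 := by
      linear_combination h1
    have h4 : 0 < (a ^ 2 + b ^ 2) ^ 2 - (a ^ 2 - b ^ 2) / 2 := by linear_combination h
    have h5 : (a ^ 2 + b ^ 2) ^ 2 ≤ s ^ 2 * (a ^ 2 + b ^ 2) ^ 2 :=
      le_mul_of_one_le_left (by positivity) (one_le_pow₀ hs)
    have h6 : 0 < s ^ 2 * (s ^ 2 * (a ^ 2 + b ^ 2) ^ 2 - (a ^ 2 - b ^ 2) / 2) :=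
      mul_pos (by positivity) (by linarith)
    exact h6.ne' h3
  · have : 0 < s * a := mul_pos (by linarith) (by linarith)
    linarith

/-- A point of the outer region lies on an unbounded ray that misses the curve, so its component is
unbounded. -/
theorem inside_subset : inside Γ ⊆ innerRegion := by
  rintro r ⟨hr, hb⟩
  rcases compl_Γ_subset hr with h | h
  · exact h
  exfalso
  have hw : r - 1 / 2 ≠ 0 := fun hw => hr (by rw [sub_eq_zero.mp hw]; exact half_mem_Γ)
  set f : ℝ → ℂ := fun s => 1 / 2 + (s : ℂ) * (r - 1 / 2) with hf
  have hsub : f '' Set.Ici 1 ⊆ connectedComponentIn Γᶜ r := by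
    refine IsPreconnected.subset_connectedComponentIn ?_ ⟨1, by simp, by simp [hf]⟩ ?_
    · exact isPreconnected_Ici.image f (by fun_prop)
    · rintro _ ⟨s, hs, rfl⟩
      exact ray_notMem_Γ h hs
  obtain ⟨C, hC⟩ := (hb.subset hsub).exists_norm_le
  have hpos := norm_pos_iff.mpr hw
  set s : ℝ := max 1 ((C + 1) / ‖r - 1 / 2‖) with hs
  have h1 := hC (f s) ⟨s, Set.mem_Ici.mpr (le_max_left _ _), rfl⟩
  have h2 : C + 1 ≤ s * ‖r - 1 / 2‖ := (div_le_iff₀ hpos).mp (le_max_right _ _)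
  have h3 : s * ‖r - 1 / 2‖ ≤ ‖f s‖ + 1 / 2 := by
    have hs0 : 0 ≤ s := zero_le_one.trans (le_max_left _ _)
    have : (s : ℂ) * (r - 1 / 2) = f s - 1 / 2 := by simp [hf]
    calc s * ‖r - 1 / 2‖ = ‖(s : ℂ) * (r - 1 / 2)‖ := by
          rw [norm_mul, Complex.norm_of_nonneg hs0]
      _ ≤ ‖f s‖ + ‖(1 / 2 : ℂ)‖ := by rw [this]; exact norm_sub_le _ _
      _ = ‖f s‖ + 1 / 2 := by norm_num
  linarith

theorem tendsto_current_inside {r : ℂ} (hr : r ∈ inside Γ) :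
    (∀ᶠ L in atTop, Q L r ≠ 0) ∧
      Tendsto (fun L : ℕ => current L r) atTop (𝓝 (r * (1 - r))) :=
  tendsto_current_inner (inside_subset hr).1 (inside_subset hr).2

theorem tendsto_current_outside {r : ℂ} (hr : r ∈ outside Γ) :
    (∀ᶠ L in atTop, Q L r ≠ 0) ∧ Tendsto (fun L : ℕ => current L r) atTop (𝓝 (1 / 4)) := by
  rcases le_or_gt ‖r * (1 - r)‖ (1 / 4) with h | h
  · exact tendsto_current_right h ((outside_subset hr).resolve_left h.not_gt)
  · exact tendsto_current_far h

/-! ### The matrix algebra on sequences -/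

/-- The action of an empty site on sequences: the shift. -/
def emptyOp : (ℕ → ℝ) →ₗ[ℝ] (ℕ → ℝ) where
  toFun φ k := φ (k + 1)
  map_add' _ _ := rfl
  map_smul' _ _ := rfl

/-- The function underlying `fullOp`. -/
def fullFun (r : ℝ) (φ : ℕ → ℝ) : ℕ → ℝ
  | 0 => r * φ 0
  | k + 1 => r * (fullFun r φ k + φ (k + 1))

/-- The action of an occupied site on sequences. -/
def fullOp (r : ℝ) : (ℕ → ℝ) →ₗ[ℝ] (ℕ → ℝ) where
  toFun := fullFun r
  map_add' φ ψ := by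
    funext k
    induction k with
    | zero => simp [fullFun, mul_add]
    | succ k ih => simp only [fullFun, ih, Pi.add_apply]; ring
  map_smul' c φ := by
    funext k
    induction k with
    | zero => simp [fullFun]; ring
    | succ k ih => simp only [fullFun, ih, Pi.smul_apply, RingHom.id_apply, smul_eq_mul]; ring

@[simp] theorem emptyOp_apply (φ : ℕ → ℝ) (k : ℕ) : emptyOp φ k = φ (k + 1) := rfl

@[simp] theorem fullOp_zero (r : ℝ) (φ : ℕ → ℝ) : fullOp r φ 0 = r * φ 0 := rfl

@[simp] theorem fullOp_succ (r : ℝ) (φ : ℕ → ℝ) (k : ℕ) :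
    fullOp r φ (k + 1) = r * (fullOp r φ k + φ (k + 1)) := rfl

/-- The quadratic relation `D E = r (D + E)`. -/
theorem emptyOp_fullOp (r : ℝ) (φ : ℕ → ℝ) :
    emptyOp (fullOp r φ) = r • (fullOp r φ + emptyOp φ) := rfl

/-- The action of a site with the given occupation. -/
def siteOp (r : ℝ) (b : Bool) : (ℕ → ℝ) →ₗ[ℝ] (ℕ → ℝ) := if b then fullOp r else emptyOp

@[simp] theorem siteOp_true (r : ℝ) : siteOp r true = fullOp r := rfl

@[simp] theorem siteOp_false (r : ℝ) : siteOp r false = emptyOp := rfl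

/-- The state vector after reading the occupations of the sites `1, …, n`. -/
def weightSeq (r : ℝ) (o : ℕ → Bool) : ℕ → ℕ → ℝ
  | 0 => fun _ => 1
  | n + 1 => siteOp r (o (n + 1)) (weightSeq r o n)

/-- The stationary weight of the occupations `o` of the sites `1, …, n`. -/
def weight (r : ℝ) (o : ℕ → Bool) (n : ℕ) : ℝ := weightSeq r o n 0

theorem weightSeq_succ (r : ℝ) (o : ℕ → Bool) (n : ℕ) :
    weightSeq r o (n + 1) = siteOp r (o (n + 1)) (weightSeq r o n) := rfl

theorem weightSeq_congr (r : ℝ) {o o' : ℕ → Bool} {n : ℕ}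
    (h : ∀ k, 1 ≤ k → k ≤ n → o k = o' k) : weightSeq r o n = weightSeq r o' n := by
  induction n with
  | zero => rfl
  | succ n ih =>
    rw [weightSeq_succ, weightSeq_succ, h (n + 1) (by omega) le_rfl,
      ih fun k h1 h2 => h k h1 (by omega)]

theorem siteOp_nonneg {r : ℝ} (hr : 0 ≤ r) (b : Bool) {φ : ℕ → ℝ} (h : ∀ k, 0 ≤ φ k) (k : ℕ) :
    0 ≤ siteOp r b φ k := by
  cases b with
  | false => exact h (k + 1)
  | true =>
    induction k with
    | zero => exact mul_nonneg hr (h 0)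
    | succ k ih => exact mul_nonneg hr (add_nonneg ih (h _))

theorem weightSeq_nonneg {r : ℝ} (hr : 0 ≤ r) (o : ℕ → Bool) (n k : ℕ) :
    0 ≤ weightSeq r o n k := by
  induction n generalizing k with
  | zero => exact zero_le_one
  | succ n ih => exact siteOp_nonneg hr _ ih k

/-- Delete the site `b`, closing the gap from the right. -/
def deleteSite (o : ℕ → Bool) (b : ℕ) : ℕ → Bool := fun k => if k < b then o k else o (k + 1)

theorem deleteSite_of_lt (o : ℕ → Bool) {b k : ℕ} (h : k < b) : deleteSite o b k = o k := if_pos h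

theorem deleteSite_of_le (o : ℕ → Bool) {b k : ℕ} (h : b ≤ k) :
    deleteSite o b k = o (k + 1) := if_neg h.not_gt

theorem weightSeq_deleteSite (r : ℝ) (o : ℕ → Bool) {b n : ℕ} (h : n < b) :
    weightSeq r (deleteSite o b) n = weightSeq r o n :=
  weightSeq_congr r fun _ _ h2 => deleteSite_of_lt o (h2.trans_lt h)

/-- The quadratic relation at the sites b + 1 and b + 2, carried through all later sites by
linearity. Deleting the hole keeps the particle, and conversely. -/
theorem weightSeq_bulk (r : ℝ) {o : ℕ → Bool} {b : ℕ} (h1 : o (b + 1) = true)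
    (h2 : o (b + 2) = false) (n : ℕ) :
    weightSeq r o (b + 2 + n) = r • (weightSeq r (deleteSite o (b + 2)) (b + 1 + n) +
      weightSeq r (deleteSite o (b + 1)) (b + 1 + n)) := by
  induction n with
  | zero =>
    simp only [add_zero]
    rw [weightSeq_succ, weightSeq_succ, h1, h2, weightSeq_succ, weightSeq_succ,
      deleteSite_of_lt _ (by omega), deleteSite_of_le _ le_rfl, h1, h2,
      weightSeq_deleteSite _ _ (by omega), weightSeq_deleteSite _ _ (by omega)]
    rfl
  | succ n ih =>
    rw [← add_assoc, ← add_assoc, weightSeq_succ, ih, weightSeq_succ, weightSeq_succ,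
      deleteSite_of_le _ (by omega), deleteSite_of_le _ (by omega), map_smul, map_add,
      show b + 1 + n + 1 + 1 = b + 2 + n + 1 by ring]

theorem weightSeq_entry (r : ℝ) {o : ℕ → Bool} (h : o 1 = false) (n : ℕ) :
    weightSeq r o (n + 1) = weightSeq r (deleteSite o 1) n := by
  induction n with
  | zero =>
    rw [weightSeq_succ, h]
    rfl
  | succ n ih => rw [weightSeq_succ, ih, weightSeq_succ, deleteSite_of_le _ (by omega)]

theorem weight_exit (r : ℝ) {o : ℕ → Bool} {n : ℕ} (h : o (n + 1) = true) :
    weight r o (n + 1) = r * weight r (deleteSite o (n + 1)) n := by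
  unfold weight
  rw [weightSeq_succ, h, weightSeq_deleteSite _ _ (Nat.lt_succ_self n)]
  rfl

theorem weight_congr (r : ℝ) {o o' : ℕ → Bool} {n : ℕ}
    (h : ∀ k, 1 ≤ k → k ≤ n → o k = o' k) : weight r o n = weight r o' n :=
  congrFun (weightSeq_congr r h) 0

theorem weight_bulk (r : ℝ) {o : ℕ → Bool} {b n : ℕ} (hb : 1 ≤ b) (hbn : b ≤ n)
    (h1 : o b = true) (h2 : o (b + 1) = false) :
    weight r o (n + 1)
      = r * (weight r (deleteSite o (b + 1)) n + weight r (deleteSite o b) n) := by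
  obtain ⟨b, rfl⟩ := Nat.exists_eq_add_of_le' hb
  obtain ⟨m, rfl⟩ := Nat.exists_eq_add_of_le hbn
  have := congrFun (weightSeq_bulk r h1 h2 m) 0
  rw [show b + 1 + m + 1 = b + 2 + m by ring]
  exact this

/-- Makes the flux terms cancel at a bond between equally occupied sites, where nothing can jump. -/
theorem weight_deleteSite_succ (r : ℝ) {o : ℕ → Bool} {b : ℕ} (h : o b = o (b + 1)) (n : ℕ) :
    weight r (deleteSite o (b + 1)) n = weight r (deleteSite o b) n := by
  refine weight_congr r fun k _ _ => ?_
  unfold deleteSite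
  rcases lt_trichotomy k b with h' | rfl | h'
  · rw [if_pos (by omega), if_pos h']
  · rw [if_pos (by omega), if_neg (by omega), h]
  · rw [if_neg (by omega), if_neg (by omega)]

/-! ### Occupations and jumps -/

theorem occ_zero {L : ℕ} (η : Config L) : occ η 0 = true := rfl

theorem occ_succ {L : ℕ} (η : Config L) {k : ℕ} (h : k < L) : occ η (k + 1) = η ⟨k, h⟩ :=
  dif_pos h

theorem occ_of_lt {L : ℕ} (η : Config L) {k : ℕ} (h : L < k) : occ η k = false := by
  obtain ⟨k, rfl⟩ := Nat.exists_eq_add_of_lt h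
  exact dif_neg (by omega)

/-- The configuration before a jump across the bond `b`. -/
def unjump {L : ℕ} (η : Config L) (b : ℕ) : Config L := fun i =>
  if (i : ℕ) + 1 = b then true else if (i : ℕ) = b then false else η i

/-- The configuration may result from a jump across the bond `b`. -/
def CanUnjump {L : ℕ} (η : Config L) (b : ℕ) : Prop :=
  (b = 0 ∨ occ η b = false) ∧ (b = L ∨ occ η (b + 1) = true)

instance {L : ℕ} (η : Config L) (b : ℕ) : Decidable (CanUnjump η b) := by
  unfold CanUnjump; infer_instance

theorem occ_unjump {L : ℕ} (η : Config L) (b : ℕ) {k : ℕ} (h1 : 1 ≤ k) (h2 : k ≤ L) :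
    occ (unjump η b) k = if k = b then true else if k = b + 1 then false else occ η k := by
  obtain ⟨k, rfl⟩ := Nat.exists_eq_add_of_le' h1
  rw [occ_succ _ (by omega), occ_succ _ (by omega)]
  simp [unjump]

theorem occ_jump {L : ℕ} (η : Config L) (b : ℕ) {k : ℕ} (h1 : 1 ≤ k) (h2 : k ≤ L) :
    occ (jump η b) k = if k = b then false else if k = b + 1 then true else occ η k := by
  obtain ⟨k, rfl⟩ := Nat.exists_eq_add_of_le' h1
  rw [occ_succ _ (by omega), occ_succ _ (by omega)]
  simp [jump]

theorem config_ext {L : ℕ} {η ζ : Config L} (h : ∀ k, 1 ≤ k → k ≤ L → occ η k = occ ζ k) :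
    η = ζ := by
  funext i
  have := h (i + 1) (by omega) (by omega)
  rwa [occ_succ _ i.2, occ_succ _ i.2] at this

theorem canJump_and_jump_eq_iff {L : ℕ} {η ζ : Config L} {b : ℕ} (hb : b ≤ L) :
    CanJump η b ∧ jump η b = ζ ↔ CanUnjump ζ b ∧ η = unjump ζ b := by
  constructor
  · rintro ⟨⟨h1, h2⟩, rfl⟩
    refine ⟨⟨?_, ?_⟩, config_ext fun k hk1 hk2 => ?_⟩
    · rcases Nat.eq_zero_or_pos b with h | h
      · exact Or.inl h
      · right
        rw [occ_jump _ _ h hb, if_pos rfl]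
    · rcases hb.eq_or_lt with h | h
      · exact Or.inl h
      · right
        rw [occ_jump _ _ (by omega) h, if_neg (by omega), if_pos rfl]
    · rw [occ_unjump _ _ hk1 hk2, occ_jump _ _ hk1 hk2]
      split_ifs with h h'
      · rw [h, h1]
      · rw [h', h2]
      · rfl
  · rintro ⟨⟨h1, h2⟩, rfl⟩
    refine ⟨⟨?_, ?_⟩, config_ext fun k hk1 hk2 => ?_⟩
    · rcases Nat.eq_zero_or_pos b with rfl | h
      · rfl
      · rw [occ_unjump _ _ h hb, if_pos rfl]
    · rcases hb.eq_or_lt with h | h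
      · exact occ_of_lt _ (by omega)
      · rw [occ_unjump _ _ (by omega) h, if_neg (by omega), if_pos rfl]
    · rw [occ_jump _ _ hk1 hk2, occ_unjump _ _ hk1 hk2]
      split_ifs with h h'
      · subst h
        exact (h1.resolve_left (by omega)).symm
      · subst h'
        exact (h2.resolve_left (by omega)).symm
      · rfl

theorem jump_ne {L : ℕ} (hL : 1 ≤ L) {η : Config L} {b : ℕ} (hb : b ≤ L) (h : CanJump η b) :
    jump η b ≠ η := by
  intro he
  rcases Nat.eq_zero_or_pos b with rfl | hb0
  · have := occ_jump η 0 le_rfl hL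
    rw [he, h.2] at this
    simp at this
  · have := occ_jump η b hb0 hb
    rw [he, h.1] at this
    simp at this

/-- A site is needed: for `L = 0` the only configuration is fixed by a jump across the bond 0. -/
theorem transRate_self {L : ℕ} (hL : 1 ≤ L) (r : ℝ) (η : Config L) : transRate r η η = 0 := by
  refine Finset.sum_eq_zero fun b hb => if_neg ?_
  rintro ⟨h1, h2⟩
  exact jump_ne hL (Nat.lt_succ_iff.mp (Finset.mem_range.mp hb)) h1 h2

theorem sum_transRate_mul {L : ℕ} (r : ℝ) (η : Config L) (f : Config L → ℝ) :
    ∑ ζ, transRate r η ζ * f ζ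
      = ∑ b ∈ Finset.range (L + 1), if CanJump η b then bondRate r b * f (jump η b) else 0 := by
  simp only [transRate, Finset.sum_mul, ite_mul, zero_mul]
  rw [Finset.sum_comm]
  refine Finset.sum_congr rfl fun b _ => ?_
  by_cases h : CanJump η b <;> simp [h]

theorem sum_mul_transRate {L : ℕ} (r : ℝ) (ζ : Config L) (f : Config L → ℝ) :
    ∑ η, transRate r η ζ * f η
      = ∑ b ∈ Finset.range (L + 1),
          if CanUnjump ζ b then bondRate r b * f (unjump ζ b) else 0 := by
  simp only [transRate, Finset.sum_mul, ite_mul, zero_mul]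
  rw [Finset.sum_comm]
  refine Finset.sum_congr rfl fun b hb => ?_
  simp only [canJump_and_jump_eq_iff (Nat.lt_succ_iff.mp (Finset.mem_range.mp hb))]
  by_cases h : CanUnjump ζ b <;> simp [h]

theorem sum_erase_transRate {L : ℕ} (hL : 1 ≤ L) (r : ℝ) (η : Config L) :
    ∑ ξ ∈ Finset.univ.erase η, transRate r η ξ = ∑ ξ, transRate r η ξ :=
  Finset.sum_erase _ (transRate_self hL r η)

theorem generator_eq {L : ℕ} (hL : 1 ≤ L) (r : ℝ) (ζ η : Config L) :
    generator L r ζ η = transRate r η ζ - if ζ = η then ∑ ξ, transRate r η ξ else 0 := by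
  unfold generator
  split_ifs with h
  · rw [sum_erase_transRate hL, h, transRate_self hL, zero_sub]
  · rw [sub_zero]

theorem generator_mulVec {L : ℕ} (hL : 1 ≤ L) (r : ℝ) (f : Config L → ℝ) (ζ : Config L) :
    (generator L r).mulVec f ζ = ∑ b ∈ Finset.range (L + 1),
      ((if CanUnjump ζ b then bondRate r b * f (unjump ζ b) else 0) -
        if CanJump ζ b then bondRate r b * f ζ else 0) := by
  rw [Finset.sum_sub_distrib, ← sum_mul_transRate]
  have h := sum_transRate_mul r ζ fun _ => f ζ
  rw [← h, ← Finset.sum_mul]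
  simp only [Matrix.mulVec, dotProduct, generator_eq hL, sub_mul, ite_mul, zero_mul,
    Finset.sum_sub_distrib, Finset.sum_ite_eq, Finset.mem_univ, if_true]

theorem generator_transpose_mulVec {L : ℕ} (hL : 1 ≤ L) (r : ℝ) (h : Config L → ℝ)
    (η : Config L) :
    (generator L r).transpose.mulVec h η = ∑ b ∈ Finset.range (L + 1),
      if CanJump η b then bondRate r b * (h (jump η b) - h η) else 0 := by
  have e := sum_transRate_mul r η fun ζ => h ζ - h η
  rw [← e]
  simp only [Matrix.mulVec, dotProduct, Matrix.transpose_apply, generator_eq hL, sub_mul, ite_mul,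
    zero_mul, Finset.sum_sub_distrib, Finset.sum_ite_eq', Finset.mem_univ, if_true, mul_sub]
  rw [Finset.sum_mul]

/-! ### Stationarity of the weights -/

/-- The flux terms by which the master equation of the weights telescopes. -/
def hatWeight (r : ℝ) {L : ℕ} (ζ : Config L) (b : ℕ) : ℝ :=
  if b = 0 ∨ b = L + 1 then 0
  else (if occ ζ b then r else -r) * weight r (deleteSite (occ ζ) b) (L - 1)

theorem hatWeight_zero (r : ℝ) {L : ℕ} (ζ : Config L) : hatWeight r ζ 0 = 0 := by simp [hatWeight]

theorem hatWeight_last (r : ℝ) {L : ℕ} (ζ : Config L) : hatWeight r ζ (L + 1) = 0 := by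
  simp [hatWeight]

theorem hatWeight_of_mem (r : ℝ) {L : ℕ} (ζ : Config (L + 1)) {b : ℕ} (h1 : 1 ≤ b)
    (h2 : b ≤ L + 1) :
    hatWeight r ζ b = (if occ ζ b then r else -r) * weight r (deleteSite (occ ζ) b) L := by
  rw [hatWeight, if_neg (by omega), Nat.add_sub_cancel]

/-- Gain minus loss at one bond. The entry bond uses shift invariance of the initial sequence, the
exit bond evaluation at 0, and an interior bond the quadratic relation, with the sign of `hatWeight`
recording the occupation. -/
theorem flux_eq (r : ℝ) {L : ℕ} (ζ : Config (L + 1)) {b : ℕ} (hb : b ≤ L + 1) :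
    ((if CanUnjump ζ b then bondRate r b * weight r (occ (unjump ζ b)) (L + 1) else 0) -
        if CanJump ζ b then bondRate r b * weight r (occ ζ) (L + 1) else 0)
      = hatWeight r ζ (b + 1) - hatWeight r ζ b := by
  rcases Nat.eq_zero_or_pos b with rfl | hb0
  · rw [hatWeight_zero, hatWeight_of_mem _ _ le_rfl (by omega), sub_zero]
    cases h : occ ζ (0 + 1) with
    | true =>
      have e : weight r (occ (unjump ζ 0)) (L + 1) = weight r (deleteSite (occ ζ) 1) L := by
        refine (congrFun (weightSeq_entry r ?_ L) 0).trans (weight_congr r fun k h1 h2 => ?_)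
        · rw [occ_unjump _ _ le_rfl (by omega)]
          simp
        · rw [deleteSite_of_le _ h1, deleteSite_of_le _ h1, occ_unjump _ _ (by omega) (by omega),
            if_neg (by omega), if_neg (by omega)]
      have h1 : CanUnjump ζ 0 := ⟨Or.inl rfl, Or.inr h⟩
      have h2 : ¬CanJump ζ 0 := fun h' => by simp [h'.2] at h
      simp [h1, h2, e, bondRate]
    | false =>
      have e : weight r (occ ζ) (L + 1) = weight r (deleteSite (occ ζ) 1) L :=
        congrFun (weightSeq_entry r h L) 0
      have h1 : ¬CanUnjump ζ 0 := fun h' => by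
        rcases h'.2 with h'' | h'' <;> simp [h] at h''
      have h2 : CanJump ζ 0 := ⟨rfl, h⟩
      simp [h1, h2, e, bondRate]
  rw [show bondRate r b = 1 from if_neg hb0.ne', one_mul, one_mul]
  rcases hb.eq_or_lt with rfl | hbL
  · rw [hatWeight_last, hatWeight_of_mem _ _ (by omega) le_rfl, zero_sub]
    have hlast : occ ζ (L + 1 + 1) = false := occ_of_lt _ (by omega)
    cases h : occ ζ (L + 1) with
    | true =>
      have h1 : ¬CanUnjump ζ (L + 1) := fun h' => by
        rcases h'.1 with h'' | h'' <;> simp [h] at h''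
      have h2 : CanJump ζ (L + 1) := ⟨h, hlast⟩
      simp [h1, h2, weight_exit r h]
    | false =>
      have e : weight r (occ (unjump ζ (L + 1))) (L + 1)
          = r * weight r (deleteSite (occ ζ) (L + 1)) L := by
        rw [weight_exit]
        · congr 1
          refine weight_congr r fun k h1 h2 => ?_
          rw [deleteSite_of_lt _ (by omega), deleteSite_of_lt _ (by omega),
            occ_unjump _ _ h1 (by omega), if_neg (by omega), if_neg (by omega)]
        · rw [occ_unjump _ _ (by omega) le_rfl, if_pos rfl]
      have h1 : CanUnjump ζ (L + 1) := ⟨Or.inr h, Or.inl rfl⟩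
      have h2 : ¬CanJump ζ (L + 1) := fun h' => by simp [h'.1] at h
      simp [h1, h2, e]
  · rw [hatWeight_of_mem _ _ hb0 hb, hatWeight_of_mem _ _ (by omega) (by omega)]
    have hcu : CanUnjump ζ b ↔ occ ζ b = false ∧ occ ζ (b + 1) = true := by
      simp [CanUnjump, hb0.ne', hbL.ne]
    have hcj : CanJump ζ b ↔ occ ζ b = true ∧ occ ζ (b + 1) = false := Iff.rfl
    simp only [hcu, hcj]
    cases h : occ ζ b <;> cases h' : occ ζ (b + 1)
    · simp [weight_deleteSite_succ r (h.trans h'.symm)]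
    · have e : weight r (occ (unjump ζ b)) (L + 1)
          = r * (weight r (deleteSite (occ ζ) b) L + weight r (deleteSite (occ ζ) (b + 1)) L) := by
        rw [weight_bulk r (b := b) hb0 (by omega)]
        · congr 2
          · refine weight_congr r fun k h1 h2 => ?_
            rcases lt_trichotomy k b with hk | rfl | hk
            · rw [deleteSite_of_lt _ (by omega), deleteSite_of_lt _ hk,
                occ_unjump _ _ h1 (by omega), if_neg (by omega), if_neg (by omega)]
            · rw [deleteSite_of_lt _ (by omega), deleteSite_of_le _ le_rfl,
                occ_unjump _ _ h1 (by omega), if_pos rfl, h']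
            · rw [deleteSite_of_le _ (by omega), deleteSite_of_le _ (by omega),
                occ_unjump _ _ (by omega) (by omega), if_neg (by omega), if_neg (by omega)]
          · refine weight_congr r fun k h1 h2 => ?_
            rcases lt_trichotomy k b with hk | rfl | hk
            · rw [deleteSite_of_lt _ (by omega), deleteSite_of_lt _ (by omega),
                occ_unjump _ _ h1 (by omega), if_neg (by omega), if_neg (by omega)]
            · rw [deleteSite_of_le _ le_rfl, deleteSite_of_lt _ (by omega),
                occ_unjump _ _ (by omega) (by omega), if_neg (by omega), if_pos rfl, h]
            · rw [deleteSite_of_le _ (by omega), deleteSite_of_le _ (by omega),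
                occ_unjump _ _ (by omega) (by omega), if_neg (by omega), if_neg (by omega)]
        · rw [occ_unjump _ _ hb0 hb, if_pos rfl]
        · rw [occ_unjump _ _ (by omega) (by omega), if_neg (by omega), if_pos rfl]
      simp [e]
      ring
    · have e := weight_bulk r hb0 (n := L) (by omega) h h'
      simp [e]
      ring
    · simp [weight_deleteSite_succ r (h.trans h'.symm)]

theorem generator_mulVec_weight {L : ℕ} (hL : 1 ≤ L) (r : ℝ) :
    (generator L r).mulVec (fun η => weight r (occ η) L) = 0 := by
  obtain ⟨L, rfl⟩ := Nat.exists_eq_add_of_le' hL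
  funext ζ
  rw [generator_mulVec hL, Finset.sum_congr rfl fun b hb =>
    flux_eq r ζ (Nat.lt_succ_iff.mp (Finset.mem_range.mp hb)), Finset.sum_range_sub,
    hatWeight_zero, hatWeight_last, sub_zero]
  rfl

/-! ### The partition function and the bond currents -/

theorem sum_config_succ {M : Type*} [AddCommMonoid M] {n : ℕ} (F : Config (n + 1) → M) :
    ∑ η, F η = ∑ η : Config n,
      (F (Fin.snoc (α := fun _ => Bool) η true) + F (Fin.snoc (α := fun _ => Bool) η false)) := by
  rw [← (Fin.snocEquiv fun _ => Bool).sum_comp, Fintype.sum_prod_type_right]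
  refine Finset.sum_congr rfl fun η _ => ?_
  rw [Fintype.sum_bool]
  rfl

theorem occ_snoc_of_le {n : ℕ} (η : Config n) (x : Bool) {k : ℕ} (h : k ≤ n) :
    occ (Fin.snoc (α := fun _ => Bool) η x : Config (n + 1)) k = occ η k := by
  rcases Nat.eq_zero_or_pos k with rfl | hk
  · rfl
  obtain ⟨k, rfl⟩ := Nat.exists_eq_add_of_le' hk
  rw [occ_succ _ (by omega), occ_succ _ (by omega)]
  exact Fin.snoc_castSucc (α := fun _ => Bool) x η ⟨k, by omega⟩

theorem occ_snoc_last {n : ℕ} (η : Config n) (x : Bool) :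
    occ (Fin.snoc (α := fun _ => Bool) η x : Config (n + 1)) (n + 1) = x := by
  rw [occ_succ _ (Nat.lt_succ_self n)]
  exact Fin.snoc_last (α := fun _ => Bool) x η

theorem canJump_snoc {n : ℕ} (η : Config n) (x : Bool) {b : ℕ} (h : b < n) :
    CanJump (Fin.snoc (α := fun _ => Bool) η x : Config (n + 1)) b ↔ CanJump η b := by
  unfold CanJump
  rw [occ_snoc_of_le η x h.le, occ_snoc_of_le η x h]

theorem weightSeq_snoc (r : ℝ) {n : ℕ} (η : Config n) (x : Bool) :
    weightSeq r (occ (Fin.snoc (α := fun _ => Bool) η x : Config (n + 1))) (n + 1)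
      = siteOp r x (weightSeq r (occ η) n) := by
  rw [weightSeq_succ, occ_snoc_last]
  congr 1
  exact weightSeq_congr r fun k _ h => occ_snoc_of_le η x h

/-- The sum of the operators of an occupied and an empty site. -/
def sumOp (r : ℝ) : (ℕ → ℝ) →ₗ[ℝ] (ℕ → ℝ) := fullOp r + emptyOp

/-- The sum of the state vectors over all configurations on `n` sites. -/
def totalSeq (r : ℝ) (n : ℕ) : ℕ → ℝ := ∑ η : Config n, weightSeq r (occ η) n

theorem totalSeq_zero (r : ℝ) : totalSeq r 0 = fun _ => 1 := by
  simp [totalSeq, weightSeq]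

theorem totalSeq_succ (r : ℝ) (n : ℕ) : totalSeq r (n + 1) = sumOp r (totalSeq r n) := by
  simp only [totalSeq, sum_config_succ, weightSeq_snoc, map_sum, siteOp_true, siteOp_false]
  rfl

theorem totalSeq_eq_pow (r : ℝ) (n : ℕ) : totalSeq r n = (sumOp r ^ n) fun _ => 1 := by
  induction n with
  | zero => simp [totalSeq_zero]
  | succ n ih => rw [totalSeq_succ, ih, pow_succ', Module.End.mul_apply]

/-- The sum of the state vectors over the configurations with a possible jump across a bond that
is not the last one. -/
theorem sum_canJump_weightSeq (r : ℝ) (b m : ℕ) :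
    bondRate r b • ∑ η : Config (b + 1 + m),
        (if CanJump η b then weightSeq r (occ η) (b + 1 + m) else 0)
      = r • totalSeq r (b + m) := by
  induction m with
  | zero =>
    simp only [add_zero]
    cases b with
    | zero =>
      rw [show bondRate r 0 = r from if_pos rfl, sum_config_succ]
      simp only [CanJump, occ_zero, occ_snoc_last, weightSeq_snoc]
      simp [totalSeq, weightSeq]
      rfl
    | succ c =>
      rw [show bondRate r (c + 1) = 1 from if_neg (Nat.succ_ne_zero c), one_smul, sum_config_succ,
        sum_config_succ, totalSeq_succ, totalSeq, sumOp, map_sum, Finset.smul_sum]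
      refine Finset.sum_congr rfl fun η _ => ?_
      simp only [CanJump, occ_snoc_last, occ_snoc_of_le _ _ le_rfl, weightSeq_snoc]
      -- Only the pattern particle-hole on the last two sites survives, and the quadratic relation
      -- turns it into r(D + E).
      simp [emptyOp_fullOp]
  | succ m ih =>
    rw [← add_assoc, ← add_assoc, totalSeq_succ, ← map_smul, ← ih, sum_config_succ, map_smul,
      map_sum]
    congr 1
    refine Finset.sum_congr rfl fun η _ => ?_
    rw [weightSeq_snoc, weightSeq_snoc]
    simp only [canJump_snoc η _ (show b < b + 1 + m by omega)]
    split_ifs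
    · rfl
    · simp

theorem bondCurrent_weight (r : ℝ) {L b : ℕ} (hb : b ≤ L + 1) :
    bondCurrent r (fun η : Config (L + 1) => weight r (occ η) (L + 1)) b
      = r * totalSeq r L 0 := by
  rcases hb.lt_or_eq with h | rfl
  · obtain ⟨m, rfl⟩ := Nat.exists_eq_add_of_le (Nat.lt_succ_iff.mp h)
    have e := congrFun (sum_canJump_weightSeq r b m) 0
    rw [Pi.smul_apply, Pi.smul_apply, Finset.sum_apply, smul_eq_mul, smul_eq_mul,
      Finset.mul_sum] at e
    rw [← e, bondCurrent, show b + m + 1 = b + 1 + m by ring]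
    refine Finset.sum_congr rfl fun η _ => ?_
    split_ifs
    · rfl
    · simp
  -- The exit bond has no site on its right; evaluation of `fullOp` at 0 supplies the factor r.
  · rw [bondCurrent, sum_config_succ, totalSeq, Finset.sum_apply, Finset.mul_sum]
    refine Finset.sum_congr rfl fun η _ => ?_
    rw [show bondRate r (L + 1) = 1 from if_neg (Nat.succ_ne_zero L)]
    simp only [CanJump, occ_snoc_last, occ_of_lt _ (Nat.lt_succ_self (L + 1)), weight,
      weightSeq_snoc]
    simp

theorem sumOp_apply (r : ℝ) (φ : ℕ → ℝ) (k : ℕ) :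
    sumOp r φ k = ∑ p ∈ Finset.HasAntidiagonal.antidiagonal (k + 1), r ^ p.1 * φ p.2 := by
  induction k with
  | zero =>
    rw [Finset.Nat.sum_antidiagonal_succ]
    simp [sumOp]
    ring
  | succ k ih =>
    rw [Finset.Nat.sum_antidiagonal_succ]
    simp only [pow_succ', mul_assoc, ← Finset.mul_sum]
    rw [← ih]
    simp [sumOp]
    ring

theorem sumOp_pow_apply_zero (r : ℝ) (n : ℕ) (φ : ℕ → ℝ) :
    (sumOp r ^ n) φ 0
      = ∑ p ∈ Finset.HasAntidiagonal.antidiagonal n, (ballot n p.1 : ℝ) * r ^ p.1 * φ p.2 := by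
  induction n generalizing φ with
  | zero => simp [ballot_zero_right]
  | succ n ih =>
    rw [pow_succ, Module.End.mul_apply, ih]
    -- The inner antidiagonal of p.2 + 1 becomes that of p.2 after extending the outer one to n + 1;
    -- the new endpoint p = (n + 1, 0) contributes nothing, by `ballot_succ_self`.
    have e1 : ∑ p ∈ Finset.HasAntidiagonal.antidiagonal n, (ballot n p.1 : ℝ) * r ^ p.1 * sumOp r φ p.2
        = ∑ p ∈ Finset.HasAntidiagonal.antidiagonal (n + 1), (ballot n p.1 : ℝ) * r ^ p.1 *
            ∑ q ∈ Finset.HasAntidiagonal.antidiagonal p.2, r ^ q.1 * φ q.2 := by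
      rw [Finset.Nat.sum_antidiagonal_succ']
      simp [ballot_succ_self, sumOp_apply]
    have e2 : ∀ p : ℕ × ℕ, (ballot (n + 1) p.1 : ℝ) * r ^ p.1 * φ p.2
        = ∑ q ∈ Finset.HasAntidiagonal.antidiagonal p.1, (ballot n q.1 : ℝ) * r ^ q.1 * (r ^ q.2 * φ p.2) := by
      intro p
      have h : (ballot (n + 1) p.1 : ℝ) = ∑ q ∈ Finset.HasAntidiagonal.antidiagonal p.1, (ballot n q.1 : ℝ) := by
        rw [← sum_ballot, Finset.Nat.sum_antidiagonal_eq_sum_range_succ_mk]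
        push_cast
        rfl
      rw [h, Finset.sum_mul, Finset.sum_mul]
      refine Finset.sum_congr rfl fun q hq => ?_
      rw [← Finset.HasAntidiagonal.mem_antidiagonal.mp hq, pow_add]
      ring
    rw [e1]
    simp only [e2, Finset.mul_sum, Finset.sum_sigma']
    apply Finset.sum_nbij' (fun x => ⟨(x.1.1 + x.2.1, x.2.2), (x.1.1, x.2.1)⟩)
      (fun x => ⟨(x.2.1, x.2.2 + x.1.2), (x.2.2, x.1.2)⟩)
    · rintro ⟨⟨i, j⟩, ⟨k, l⟩⟩ h
      simp at h ⊢
      omega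
    · rintro ⟨⟨i, j⟩, ⟨k, l⟩⟩ h
      simp at h ⊢
      omega
    · rintro ⟨⟨i, j⟩, ⟨k, l⟩⟩ h
      simp at h
      simp [h.2]
    · rintro ⟨⟨i, j⟩, ⟨k, l⟩⟩ h
      simp at h
      simp [h.2]
    · intros
      rfl

theorem totalSeq_apply_zero (r : ℝ) (n : ℕ) :
    totalSeq r n 0 = ∑ j ∈ Finset.range (n + 1), (ballot n j : ℝ) * r ^ j := by
  rw [totalSeq_eq_pow, sumOp_pow_apply_zero, Finset.Nat.sum_antidiagonal_eq_sum_range_succ_mk]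
  simp

/-! ### Uniqueness of the stationary distribution -/

/-- The empty configuration. -/
def emptyConfig (L : ℕ) : Config L := fun _ => false

/-- Read from the right: the site L + 1 is empty, and if the site b + 1 is empty then a blocked bond
b forces the site b to be empty. -/
theorem eq_emptyConfig {L : ℕ} {η : Config L} (h : ∀ b, 1 ≤ b → b ≤ L → ¬CanJump η b) :
    η = emptyConfig L := by
  have key : ∀ m ≤ L, occ η (L + 1 - m) = false := by
    intro m hm
    induction m with
    | zero => exact occ_of_lt _ (by omega)
    | succ m ih =>
      by_contra hc
      refine h (L + 1 - (m + 1)) (by omega) (by omega) ⟨by simpa using hc, ?_⟩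
      rw [show L + 1 - (m + 1) + 1 = L + 1 - m by omega]
      exact ih (by omega)
  refine config_ext fun k h1 h2 => ?_
  have := key (L + 1 - k) (by omega)
  rw [show L + 1 - (L + 1 - k) = k by omega] at this
  obtain ⟨k, rfl⟩ := Nat.exists_eq_add_of_le' h1
  rw [this, occ_succ _ (by omega)]
  rfl

theorem toLex_jump_lt {L : ℕ} {η : Config L} {b : ℕ} (h1 : 1 ≤ b) (h2 : b ≤ L)
    (h : CanJump η b) : toLex (jump η b) < toLex η := by
  obtain ⟨c, rfl⟩ := Nat.exists_eq_add_of_le' h1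
  refine ⟨⟨c, h2⟩, fun j hj => ?_, ?_⟩
  · have : (j : ℕ) < c := hj
    change jump η (c + 1) j = η j
    rw [jump, if_neg (by omega), if_neg (by omega)]
  · have h3 := h.1
    rw [occ_succ _ h2] at h3
    change jump η (c + 1) ⟨c, h2⟩ < η ⟨c, h2⟩
    simp [jump, h3]

/-- The maximum principle: a function in the kernel of the transposed generator is largest at the
empty configuration. -/
theorem le_emptyConfig {L : ℕ} (hL : 1 ≤ L) {r : ℝ} (hr : 0 ≤ r) {h : Config L → ℝ}
    (hh : (generator L r).transpose.mulVec h = 0) (η : Config L) : h η ≤ h (emptyConfig L) := by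
  classical
  obtain ⟨μ, -, hμ⟩ := Finset.exists_max_image Finset.univ h Finset.univ_nonempty
  -- At a maximizer every jump of positive rate leads to another maximizer, and jumps across the
  -- bonds 1, …, L lower the lexicographic order. The least maximizer thus admits none of them.
  -- Entry is not used, so r = 0 is covered.
  obtain ⟨ν, hν, hmin⟩ := Finset.exists_min_image (Finset.univ.filter fun ζ => h ζ = h μ)
    (fun ζ => toLex ζ) ⟨μ, by simp⟩
  have hνμ : h ν = h μ := (Finset.mem_filter.mp hν).2
  have hmax : ∀ ζ, h ζ ≤ h ν := fun ζ => (hμ ζ (Finset.mem_univ _)).trans_eq hνμ.symm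
  have hrate : ∀ b, 0 ≤ bondRate r b := fun b => by
    unfold bondRate
    split_ifs
    · exact hr
    · exact zero_le_one
  have hsum := congrFun hh ν
  rw [generator_transpose_mulVec hL, Pi.zero_apply, Finset.sum_eq_zero_iff_of_nonpos] at hsum
  · have : ν = emptyConfig L := by
      refine eq_emptyConfig fun b h1 h2 hc => ?_
      have hb := hsum b (Finset.mem_range.mpr (Nat.lt_succ_of_le h2))
      rw [if_pos hc, bondRate, if_neg (by omega), one_mul, sub_eq_zero] at hb
      exact (hmin _ (Finset.mem_filter.mpr ⟨Finset.mem_univ _, hb.trans hνμ⟩)).not_gt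
        (toLex_jump_lt h1 h2 hc)
    rw [← this]
    exact hmax η
  · intro b _
    split_ifs
    · exact mul_nonpos_of_nonneg_of_nonpos (hrate b) (sub_nonpos.mpr (hmax _))
    · exact le_rfl

theorem eq_const_of_transpose_mulVec {L : ℕ} (hL : 1 ≤ L) {r : ℝ} (hr : 0 ≤ r)
    {h : Config L → ℝ} (hh : (generator L r).transpose.mulVec h = 0) (η : Config L) :
    h η = h (emptyConfig L) := by
  refine (le_emptyConfig hL hr hh η).antisymm ?_
  have := le_emptyConfig hL hr (h := -h) (by rw [Matrix.mulVec_neg, hh, neg_zero]) η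
  simpa using this

/-- The kernel of the transpose consists of constants, and a square matrix and its transpose have
kernels of equal dimension. -/
theorem finrank_ker_generator_le {L : ℕ} (hL : 1 ≤ L) {r : ℝ} (hr : 0 ≤ r) :
    Module.finrank ℝ (LinearMap.ker (generator L r).mulVecLin) ≤ 1 := by
  have h1 := (generator L r).mulVecLin.finrank_range_add_finrank_ker
  have h2 := (generator L r).transpose.mulVecLin.finrank_range_add_finrank_ker
  have h3 : (generator L r).transpose.rank = (generator L r).rank := Matrix.rank_transpose _
  have h4 : Module.finrank ℝ (LinearMap.ker (generator L r).transpose.mulVecLin) ≤ 1 := by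
    refine (Submodule.finrank_mono (t := Submodule.span ℝ {fun _ => (1 : ℝ)}) fun h hh => ?_).trans
      (finrank_span_singleton fun h => one_ne_zero (congrFun h (emptyConfig L))).le
    rw [LinearMap.mem_ker, Matrix.mulVecLin_apply] at hh
    rw [Submodule.mem_span_singleton]
    refine ⟨h (emptyConfig L), ?_⟩
    funext η
    simp [eq_const_of_transpose_mulVec hL hr hh η]
  unfold Matrix.rank at h3
  omega

theorem isStationary_unique {L : ℕ} (hL : 1 ≤ L) {r : ℝ} (hr : 0 ≤ r) {p q : Config L → ℝ}
    (hp : IsStationary L r p) (hq : IsStationary L r q) : q = p := by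
  obtain ⟨v, hv⟩ := finrank_le_one_iff.mp (finrank_ker_generator_le hL hr)
  obtain ⟨a, ha⟩ := hv ⟨p, hp.2.2⟩
  obtain ⟨b, hb⟩ := hv ⟨q, hq.2.2⟩
  have ha' : a • (v : Config L → ℝ) = p := congrArg Subtype.val ha
  have hb' : b • (v : Config L → ℝ) = q := congrArg Subtype.val hb
  have h1 : a * ∑ η, (v : Config L → ℝ) η = 1 := by
    rw [← hp.2.1, ← ha', Finset.mul_sum]
    rfl
  have h2 : b * ∑ η, (v : Config L → ℝ) η = 1 := by
    rw [← hq.2.1, ← hb', Finset.mul_sum]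
    rfl
  have hs : ∑ η, (v : Config L → ℝ) η ≠ 0 := right_ne_zero_of_mul_eq_one h1
  rw [← ha', ← hb', mul_right_cancel₀ hs (h2.trans h1.symm)]

theorem stationary_current {L : ℕ} (hL : 1 ≤ L) {r : ℝ} (hr : 0 ≤ r) :
    Q L (r : ℂ) ≠ 0 ∧ ∃ p : Config L → ℝ, IsStationary L r p ∧
      (∀ q, IsStationary L r q → q = p) ∧
      ∀ b : ℕ, b ≤ L → ((bondCurrent r p b : ℝ) : ℂ) = current L (r : ℂ) := by
  have hZ : 0 < totalSeq r L 0 := by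
    rw [totalSeq_apply_zero]
    exact sum_ballot_mul_pow_pos L hr
  have hQ : ∀ n, Q n (r : ℂ) = (totalSeq r n 0 : ℝ) := fun n => by
    rw [Q_ofReal, totalSeq_apply_zero]
  set f : Config L → ℝ := fun η => weight r (occ η) L with hf
  have hst : IsStationary L r ((totalSeq r L 0)⁻¹ • f) := by
    refine ⟨fun η => ?_, ?_, ?_⟩
    · exact mul_nonneg (inv_nonneg.mpr hZ.le) (weightSeq_nonneg hr _ _ _)
    · have e : ∑ η, f η = totalSeq r L 0 := by
        rw [totalSeq, Finset.sum_apply]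
        rfl
      simp only [Pi.smul_apply, smul_eq_mul]
      rw [← Finset.mul_sum, e, inv_mul_cancel₀ hZ.ne']
    · rw [Matrix.mulVec_smul, generator_mulVec_weight hL, smul_zero]
  refine ⟨?_, _, hst, fun q hq => isStationary_unique hL hr hst hq, fun b hb => ?_⟩
  · rw [hQ]
    exact_mod_cast hZ.ne'
  · obtain ⟨n, rfl⟩ := Nat.exists_eq_add_of_le' hL
    have e : bondCurrent r ((totalSeq r (n + 1) 0)⁻¹ • f) b
        = (totalSeq r (n + 1) 0)⁻¹ * bondCurrent r f b := by
      rw [bondCurrent, bondCurrent, Finset.mul_sum]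
      refine Finset.sum_congr rfl fun η _ => ?_
      split_ifs
      · simp only [Pi.smul_apply, smul_eq_mul]
        ring
      · rw [mul_zero]
    rw [e, hf, bondCurrent_weight r hb, current_succ, hQ, hQ]
    push_cast
    ring

end SemiInfTASEP

theorem mainTheorem3 :
    -- for real `r ≥ 0` the stationary state is unique and `j_L(r)` is its current, on every bond
    (∀ L : ℕ, 1 ≤ L → ∀ r : ℝ, 0 ≤ r →
      SemiInfTASEP.Q L (r : ℂ) ≠ 0 ∧
      ∃ p : SemiInfTASEP.Config L → ℝ,
        SemiInfTASEP.IsStationary L r p ∧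
        (∀ q, SemiInfTASEP.IsStationary L r q → q = p) ∧
        ∀ b : ℕ, b ≤ L →
          ((SemiInfTASEP.bondCurrent r p b : ℝ) : ℂ) = SemiInfTASEP.current L (r : ℂ)) ∧
    -- the limit in the complex plane, on the two sides of the curve
    SemiInfTASEP.IsSimpleClosedCurve SemiInfTASEP.Γ ∧
    (∀ r ∈ SemiInfTASEP.inside SemiInfTASEP.Γ,
      (∀ᶠ L in atTop, SemiInfTASEP.Q L r ≠ 0) ∧
      Tendsto (fun L : ℕ => SemiInfTASEP.current L r) atTop (𝓝 (r * (1 - r)))) ∧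
    (∀ r ∈ SemiInfTASEP.outside SemiInfTASEP.Γ,
      (∀ᶠ L in atTop, SemiInfTASEP.Q L r ≠ 0) ∧
      Tendsto (fun L : ℕ => SemiInfTASEP.current L r) atTop (𝓝 (1 / 4))) ∧
    -- the infinite-volume current exists for all real `r ≥ 0`, and its critical value is `1/2`
    (∃ j : ℝ → ℝ,
      (∀ r : ℝ, 0 ≤ r →
        Tendsto (fun L : ℕ => SemiInfTASEP.current L (r : ℂ)) atTop (𝓝 (j r : ℂ))) ∧
      (∀ c : ℝ, SemiInfTASEP.IsCriticalValue j c ↔ c = 1 / 2)) ∧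
    -- the Taylor coefficients at `0` up to order `L + 1`
    (∀ L : ℕ, 1 ≤ L →
      AnalyticAt ℂ (SemiInfTASEP.current L) 0 ∧
      (∀ k : ℕ, k ≤ L + 1 →
        iteratedDeriv k (SemiInfTASEP.current L) 0 =
          iteratedDeriv k (fun r : ℂ => r * (1 - r)) 0) ∧
      (fun r : ℂ => SemiInfTASEP.current L r - r * (1 - r)) =O[𝓝 0]
        (fun r : ℂ => r ^ (L + 2))) :=
  ⟨fun _ hL _ hr => SemiInfTASEP.stationary_current hL hr, SemiInfTASEP.isSimpleClosedCurve_Γ,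
    fun _ hr => SemiInfTASEP.tendsto_current_inside hr,
    fun _ hr => SemiInfTASEP.tendsto_current_outside hr, SemiInfTASEP.exists_limit_current,
    fun _ hL => SemiInfTASEP.taylor_current hL⟩
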